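/- Let $\mathfrak C_{\mathbb C}=\bigoplus_{i=0}^{7}\mathbb C e_i$ be the complexified octonions: $e_0$ is the unit, $e_i^2=-e_0$ for $i\ne 0$, $e_ie_j=-e_je_i$ for distinct $i,j\neq 0$, and $e_1e_2=e_3$, $e_1e_4=e_5$, $e_1e_6=e_7$, $e_2e_5=e_7$, $e_2e_6=e_4$, $e_3e_5=e_6$, $e_3e_4=e_7$. Let $SO(8,\mathbb C)=\{g\in SL(8,\mathbb C):{}^tgg=1\}$ act on $\mathfrak C_{\mathbb C}$ in this basis and put $$SO(7,\mathbb C)=\{g\in SO(8,\mathbb C): ge_0=e_0\},\qquad G_2(\mathbb C)=\{g\in SO(8,\mathbb C):(gx)(gy)=g(xy)\ \text{for all } x,y\in\mathfrak C_{\mathbb C}\},$$ $$Spin(7,\mathbb C)=\{g\in SO(8,\mathbb C):\exists\, g_0\in SO(7,\mathbb C)\ \text{with}\ (g_0x)(gy)=g(xy)\ \text{for all } x,y\in\mathfrak C_{\mathbb C}\},\qquad SL(3,\mathbb C)=\{g\in G_2(\mathbb C):ge_1=e_1\}.$$ Let $(G_{\mathbb C},H_{\mathbb C})$ be one of the pairs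 $(SO(7,\mathbb C),G_2(\mathbb C))$, $(Spin(7,\mathbb C),G_2(\mathbb C))$, $(G_2(\mathbb C),SL(3,\mathbb C))$, with Lie algebras $\mathfrak g\supset\mathfrak h$, and let $\mathfrak q$ be the orthogonal complement of $\mathfrak h$ in $\mathfrak g$ with respect to the Killing form of $\mathfrak g$. For a Cartan involution $\theta$ of $G_{\mathbb C}$, with differential also denoted by $\theta$, put $G_u=G_{\mathbb C}^{\theta}$ and $\mathfrak g_u=\mathfrak g^{\theta}$. The complex conjugation $\theta_1(g)=\overline g$ is a Cartan involution of $G_{\mathbb C}$, and the Cartan involutions of $G_{\mathbb C}$ are precisely its conjugates $\theta_u(g)=u\,\overline{u^{-1}gu}\,u^{-1}$, $u\in G_{\mathbb C}$. (1) Let $\theta=\theta_1$, and let $\mathfrak a_0$ be, respectively for the three pairs, $$\{\operatorname{diag}(O_2,\delta_t,\delta_t,\delta_t):t\in\mathbb R\},\qquad \{\operatorname{diag}(\delta_t,\delta_{-t/3},\delta_{-t/3},\delta_{-t/3}):t\in\mathbb R\},\qquad \{\operatorname{diag}(\delta_{(0,t)},\delta_{(-t/2,-t/2)}):t\in\mathbb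 R\},$$ where $O_2$ is the $2\times 2$ zero matrix, $\delta_t=\begin{pmatrix}0&-\sqrt{-1}\,t\\ \sqrt{-1}\,t&0\end{pmatrix}$ and $\delta_{(x,y)}$ is the $4\times4$ matrix with antidiagonal entries $-\sqrt{-1}x,-\sqrt{-1}y,\sqrt{-1}y,\sqrt{-1}x$ (from the first row to the last) and all other entries $0$. Then $\mathfrak a_0$ is a one-dimensional real abelian subspace of $\sqrt{-1}\,\mathfrak g_u\cap\mathfrak q$, and $$G_{\mathbb C}=G_u\exp(\mathfrak a_0)H_{\mathbb C}.$$ (2) More generally, for every Cartan involution $\theta$ of $G_{\mathbb C}$ with $\theta(H_{\mathbb C})=H_{\mathbb C}$ there is a one-dimensional real abelian subspace $\mathfrak a_0\subset\sqrt{-1}\,\mathfrak g_u\cap\mathfrak q$ with $G_{\mathbb C}=G_u\exp(\mathfrak a_0)H_{\mathbb C}$. -/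

import Mathlib

open Matrix Complex

namespace CartanRankOne

/-- Complex `8 × 8` matrices, acting on `𝕆_ℂ` in the basis `e₀, …, e₇`. -/
abbrev Mat8 : Type := Matrix (Fin 8) (Fin 8) ℂ

/-- The group `SL(8, ℂ)`, in which all groups below live. -/
abbrev SL8 : Type := Matrix.SpecialLinearGroup (Fin 8) ℂ

/-! ### The complexified octonions -/

/-- The complexified Cayley algebra `𝕆_ℂ = ℂ e₀ ⊕ ⋯ ⊕ ℂ e₇`. -/
abbrev Oct : Type := Fin 8 → ℂ

/-- The basis vector `e i`. -/
def e (i : Fin 8) : Oct := Pi.single i 1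

/-- The complex bilinear product of the complexified octonions, in coordinates. -/
def omul (x y : Oct) : Oct :=
  ![x 0 * y 0 - x 1 * y 1 - x 2 * y 2 - x 3 * y 3 - x 4 * y 4 - x 5 * y 5 - x 6 * y 6 - x 7 * y 7,
    x 0 * y 1 + x 1 * y 0 + x 2 * y 3 - x 3 * y 2 + x 4 * y 5 - x 5 * y 4 + x 6 * y 7 - x 7 * y 6,
    x 0 * y 2 - x 1 * y 3 + x 2 * y 0 + x 3 * y 1 - x 4 * y 6 + x 5 * y 7 + x 6 * y 4 - x 7 * y 5,
    x 0 * y 3 + x 1 * y 2 - x 2 * y 1 + x 3 * y 0 + x 4 * y 7 + x 5 * y 6 - x 6 * y 5 - x 7 * y 4,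
    x 0 * y 4 - x 1 * y 5 + x 2 * y 6 - x 3 * y 7 + x 4 * y 0 + x 5 * y 1 - x 6 * y 2 + x 7 * y 3,
    x 0 * y 5 + x 1 * y 4 - x 2 * y 7 - x 3 * y 6 - x 4 * y 1 + x 5 * y 0 + x 6 * y 3 + x 7 * y 2,
    x 0 * y 6 - x 1 * y 7 - x 2 * y 4 + x 3 * y 5 + x 4 * y 2 - x 5 * y 3 + x 6 * y 0 + x 7 * y 1,
    x 0 * y 7 + x 1 * y 6 + x 2 * y 5 + x 3 * y 4 - x 4 * y 3 - x 5 * y 2 - x 6 * y 1 + x 7 * y 0]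

/-- `e₀` is the unit. -/
theorem omul_unit (x : Oct) : omul (e 0) x = x ∧ omul x (e 0) = x := by
  constructor <;> ext k <;> fin_cases k <;> simp [omul, e]

/-- `eᵢ² = -e₀` for `i ≠ 0`. -/
theorem omul_sq (i : Fin 8) (hi : i ≠ 0) : omul (e i) (e i) = -e 0 := by
  ext k; fin_cases i <;> fin_cases k <;> simp [omul, e] at hi ⊢

/-- `eᵢ eⱼ = eₖ` for the seven triples `(i, j, k)` that fix the multiplication table. -/
theorem omul_triples :
    omul (e 1) (e 2) = e 3 ∧ omul (e 1) (e 4) = e 5 ∧ omul (e 1) (e 6) = e 7 ∧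
    omul (e 2) (e 5) = e 7 ∧ omul (e 2) (e 6) = e 4 ∧ omul (e 3) (e 5) = e 6 ∧
    omul (e 3) (e 4) = e 7 := by
  refine ⟨?_, ?_, ?_, ?_, ?_, ?_, ?_⟩ <;> ext k <;> fin_cases k <;> simp [omul, e]

/-- `eᵢ eⱼ = -eⱼ eᵢ` for distinct `i, j ≠ 0`; more generally `x y + y x = -2 (x, y) e₀` for
imaginary `x` and `y`. -/
theorem omul_anticomm (x y : Oct) (hx : x 0 = 0) (hy : y 0 = 0) :
    omul x y + omul y x = (-2 * ∑ i, x i * y i) • e 0 := by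
  ext k
  fin_cases k <;> simp [omul, e, hx, hy, Fin.sum_univ_eight] <;> ring

/-- The quadratic form `x₀² + ⋯ + x₇²` is multiplicative. -/
theorem omul_norm (x y : Oct) :
    ∑ i, omul x y i ^ 2 = (∑ i, x i ^ 2) * ∑ i, y i ^ 2 := by
  simp only [omul, Fin.sum_univ_eight, Matrix.cons_val]
  ring

/-! ### The groups -/

/-- `SO(8, ℂ) = {g ∈ SL(8, ℂ) : ᵗg g = 1}`. -/
def SO8 : Subgroup SL8 where
  carrier := {g | (g : Mat8)ᵀ * (g : Mat8) = 1}
  one_mem' := by simp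
  mul_mem' := by
    intro a b ha hb
    simp only [Set.mem_ofPred_eq] at ha hb ⊢
    rw [Matrix.SpecialLinearGroup.coe_mul, Matrix.transpose_mul, Matrix.mul_assoc,
      ← Matrix.mul_assoc _ (a : Mat8), ha, Matrix.one_mul, hb]
  inv_mem' := by
    intro a ha
    simp only [Set.mem_ofPred_eq] at ha ⊢
    have h1 : (a : Mat8) * ((a⁻¹ : SL8) : Mat8) = 1 := by
      rw [← Matrix.SpecialLinearGroup.coe_mul]; simp
    have h2 : (a : Mat8)ᵀ = ((a⁻¹ : SL8) : Mat8) := left_inv_eq_right_inv ha h1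
    rw [← h2, Matrix.transpose_transpose]
    exact mul_eq_one_comm.mp ha

theorem inv_mulVec_mulVec (g : SL8) (x : Oct) :
    ((g⁻¹ : SL8) : Mat8) *ᵥ ((g : Mat8) *ᵥ x) = x := by
  rw [Matrix.mulVec_mulVec, ← Matrix.SpecialLinearGroup.coe_mul]; simp

theorem mulVec_inv_mulVec (g : SL8) (x : Oct) :
    (g : Mat8) *ᵥ (((g⁻¹ : SL8) : Mat8) *ᵥ x) = x := by
  rw [Matrix.mulVec_mulVec, ← Matrix.SpecialLinearGroup.coe_mul]; simp

/-- `SO(7, ℂ) = {g ∈ SO(8, ℂ) : g e₀ = e₀}`. -/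
def SO7 : Subgroup SL8 where
  carrier := {g | g ∈ SO8 ∧ (g : Mat8) *ᵥ e 0 = e 0}
  one_mem' := ⟨one_mem _, by simp⟩
  mul_mem' := by
    rintro a b ⟨ha, ha'⟩ ⟨hb, hb'⟩
    refine ⟨mul_mem ha hb, ?_⟩
    rw [Matrix.SpecialLinearGroup.coe_mul, ← Matrix.mulVec_mulVec, hb', ha']
  inv_mem' := by
    rintro a ⟨ha, ha'⟩
    refine ⟨inv_mem ha, ?_⟩
    have h := inv_mulVec_mulVec a (e 0)
    rwa [ha'] at h

/-- `Spin(7, ℂ)`, realized as the group of all `g ∈ SO(8, ℂ)` for which there is `g₀ ∈ SO(7, ℂ)`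
with `(g₀ x)(g y) = g (x y)` for all `x, y ∈ 𝕆_ℂ`. -/
def Spin7 : Subgroup SL8 where
  carrier := {g | g ∈ SO8 ∧ ∃ g₀ ∈ SO7, ∀ x y : Oct,
    omul ((g₀ : Mat8) *ᵥ x) ((g : Mat8) *ᵥ y) = (g : Mat8) *ᵥ omul x y}
  one_mem' := ⟨one_mem _, 1, one_mem _, by simp⟩
  mul_mem' := by
    rintro a b ⟨ha, a₀, ha₀, ha'⟩ ⟨hb, b₀, hb₀, hb'⟩
    refine ⟨mul_mem ha hb, a₀ * b₀, mul_mem ha₀ hb₀, fun x y => ?_⟩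
    simp only [Matrix.SpecialLinearGroup.coe_mul, ← Matrix.mulVec_mulVec, ha', hb']
  inv_mem' := by
    rintro a ⟨ha, a₀, ha₀, ha'⟩
    refine ⟨inv_mem ha, a₀⁻¹, inv_mem ha₀, fun x y => ?_⟩
    have h := ha' (((a₀⁻¹ : SL8) : Mat8) *ᵥ x) (((a⁻¹ : SL8) : Mat8) *ᵥ y)
    rw [mulVec_inv_mulVec, mulVec_inv_mulVec] at h
    rw [h, inv_mulVec_mulVec]

/-- `G₂(ℂ)`, the automorphism group of `𝕆_ℂ`:
`{g ∈ SO(8, ℂ) : (g x)(g y) = g (x y) for all x, y ∈ 𝕆_ℂ}`. -/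
def G2 : Subgroup SL8 where
  carrier := {g | g ∈ SO8 ∧ ∀ x y : Oct,
    omul ((g : Mat8) *ᵥ x) ((g : Mat8) *ᵥ y) = (g : Mat8) *ᵥ omul x y}
  one_mem' := ⟨one_mem _, by simp⟩
  mul_mem' := by
    rintro a b ⟨ha, ha'⟩ ⟨hb, hb'⟩
    refine ⟨mul_mem ha hb, fun x y => ?_⟩
    simp only [Matrix.SpecialLinearGroup.coe_mul, ← Matrix.mulVec_mulVec, ha', hb']
  inv_mem' := by
    rintro a ⟨ha, ha'⟩
    refine ⟨inv_mem ha, fun x y => ?_⟩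
    have h := ha' (((a⁻¹ : SL8) : Mat8) *ᵥ x) (((a⁻¹ : SL8) : Mat8) *ᵥ y)
    rw [mulVec_inv_mulVec, mulVec_inv_mulVec] at h
    rw [h, inv_mulVec_mulVec]

/-- `SL(3, ℂ)`, realized as the stabilizer of `e₁` in `G₂(ℂ)`. -/
def SL3 : Subgroup SL8 where
  carrier := {g | g ∈ G2 ∧ (g : Mat8) *ᵥ e 1 = e 1}
  one_mem' := ⟨one_mem _, by simp⟩
  mul_mem' := by
    rintro a b ⟨ha, ha'⟩ ⟨hb, hb'⟩
    refine ⟨mul_mem ha hb, ?_⟩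
    rw [Matrix.SpecialLinearGroup.coe_mul, ← Matrix.mulVec_mulVec, hb', ha']
  inv_mem' := by
    rintro a ⟨ha, ha'⟩
    refine ⟨inv_mem ha, ?_⟩
    have h := inv_mulVec_mulVec a (e 1)
    rwa [ha'] at h

/-! ### Lie algebras, Killing-orthogonal complements, Cartan involutions -/

attribute [local instance] LieRing.ofAssociativeRing

/-- The Lie algebra of a closed complex subgroup `G` of `SL(8, ℂ)`: the matrices `X` with
`exp (t X) ∈ G` for all real `t`. For such `G` these matrices already form a complex Lie subalgebra;
`lieSpan` only provides the bundled structure. -/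
noncomputable def lieAlg (G : Subgroup SL8) : LieSubalgebra ℂ Mat8 :=
  LieSubalgebra.lieSpan ℂ Mat8
    {X | ∀ t : ℝ, ∃ g ∈ G, (g : Mat8) = NormedSpace.exp ((t : ℂ) • X)}

/-- `𝔮`: the orthogonal complement of `𝔥 = Lie H` in `𝔤 = Lie G` for the Killing form of `𝔤`. -/
def killingCompl (G H : Subgroup SL8) : Set Mat8 :=
  {X | ∃ hX : X ∈ lieAlg G, ∀ Y (hY : Y ∈ lieAlg G), Y ∈ lieAlg H →
    killingForm ℂ (lieAlg G) ⟨X, hX⟩ ⟨Y, hY⟩ = 0}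

/-- Entrywise complex conjugation `g ↦ ḡ` on `SL(8, ℂ)`. -/
def conjSL : SL8 →* SL8 := Matrix.SpecialLinearGroup.map (starRingEnd ℂ)

/-- `θ_u (g) = u * conj (u⁻¹ g u) * u⁻¹`. For `u = 1` this is `θ (g) = ḡ`, whose restriction is a
Cartan involution of each of the groups `G` considered here; since any two Cartan involutions of a
connected semisimple group are conjugate by an inner automorphism, the Cartan involutions of `G` are
exactly the restrictions of `θ_u` with `u ∈ G`. -/
def theta (u g : SL8) : SL8 := u * conjSL (u⁻¹ * g * u) * u⁻¹

/-- The differential of `θ_u`. For `u = 1` it is `X ↦ X̄`. -/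
def dtheta (u : SL8) (X : Mat8) : Mat8 :=
  (u : Mat8) * (((u⁻¹ : SL8) : Mat8) * X * (u : Mat8)).map (starRingEnd ℂ) * ((u⁻¹ : SL8) : Mat8)

theorem theta_one (g : SL8) : theta 1 g = conjSL g := by simp [theta]

theorem dtheta_one (X : Mat8) : dtheta 1 X = X.map (starRingEnd ℂ) := by simp [dtheta]

/-- `G_u = G^θ` (as a set), for the involution `θ_u`. -/
def fixedGroup (G : Subgroup SL8) (u : SL8) : Set SL8 := {g | g ∈ G ∧ theta u g = g}

/-- `𝔤_u = 𝔤^θ` (as a set), for the involution `θ_u`. -/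
def fixedAlg (G : Subgroup SL8) (u : SL8) : Set Mat8 := {X | X ∈ lieAlg G ∧ dtheta u X = X}

/-- `𝔞` is a one-dimensional (real) abelian subspace of `√-1 𝔤_u ∩ 𝔮`, and
`G = G_u (exp 𝔞) H`, where `G_u` and `𝔤_u` are the fixed points of `θ_u`. -/
structure IsRankOneCartanDecomposition (G H : Subgroup SL8) (u : SL8)
    (𝔞 : Submodule ℝ Mat8) : Prop where
  finrank_eq_one : Module.finrank ℝ 𝔞 = 1
  abelian : ∀ X ∈ 𝔞, ∀ Y ∈ 𝔞, ⁅X, Y⁆ = 0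
  subset_noncompact : ∀ X ∈ 𝔞, ∃ Y ∈ fixedAlg G u, X = I • Y
  subset_compl : ∀ X ∈ 𝔞, X ∈ killingCompl G H
  decomposition : (fun g : SL8 => (g : Mat8)) '' (G : Set SL8) =
    {m | ∃ k ∈ fixedGroup G u, ∃ X ∈ 𝔞, ∃ h ∈ H,
      m = (k : Mat8) * NormedSpace.exp X * (h : Mat8)}

/-! ### The explicit abelian subspaces -/

/-- `diag(O₂, δ_t, δ_t, δ_t)`, where `δ_t` is the `2 × 2` matrix with rows `(0, -√-1 t)`, `(√-1 t, 0)`. -/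
noncomputable def alphaSO7 (t : ℂ) : Mat8 :=
  !![0, 0, 0, 0, 0, 0, 0, 0;
    0, 0, 0, 0, 0, 0, 0, 0;
    0, 0, 0, -(I * t), 0, 0, 0, 0;
    0, 0, I * t, 0, 0, 0, 0, 0;
    0, 0, 0, 0, 0, -(I * t), 0, 0;
    0, 0, 0, 0, I * t, 0, 0, 0;
    0, 0, 0, 0, 0, 0, 0, -(I * t);
    0, 0, 0, 0, 0, 0, I * t, 0]

/-- `diag(δ_t, δ_{-t/3}, δ_{-t/3}, δ_{-t/3})`, with `δ_t` as in `alphaSO7`. -/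
noncomputable def alphaSpin7 (t : ℂ) : Mat8 :=
  !![0, -(I * t), 0, 0, 0, 0, 0, 0;
    I * t, 0, 0, 0, 0, 0, 0, 0;
    0, 0, 0, -(I * (-t / 3)), 0, 0, 0, 0;
    0, 0, I * (-t / 3), 0, 0, 0, 0, 0;
    0, 0, 0, 0, 0, -(I * (-t / 3)), 0, 0;
    0, 0, 0, 0, I * (-t / 3), 0, 0, 0;
    0, 0, 0, 0, 0, 0, 0, -(I * (-t / 3));
    0, 0, 0, 0, 0, 0, I * (-t / 3), 0]

/-- `diag(δ_{(0,t)}, δ_{(-t/2,-t/2)})`, where `δ_{(x,y)}` is the `4 × 4` matrix with antidiagonal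
`-√-1 x, -√-1 y, √-1 y, √-1 x` (from top to bottom) and zeros elsewhere. -/
noncomputable def tauG2 (t : ℂ) : Mat8 :=
  !![0, 0, 0, 0, 0, 0, 0, 0;
    0, 0, -(I * t), 0, 0, 0, 0, 0;
    0, I * t, 0, 0, 0, 0, 0, 0;
    0, 0, 0, 0, 0, 0, 0, 0;
    0, 0, 0, 0, 0, 0, 0, -(I * (-t / 2));
    0, 0, 0, 0, 0, 0, -(I * (-t / 2)), 0;
    0, 0, 0, 0, 0, I * (-t / 2), 0, 0;
    0, 0, 0, 0, I * (-t / 2), 0, 0, 0]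

theorem alphaSO7_eq_smul (t : ℂ) : alphaSO7 t = t • alphaSO7 1 := by
  ext i j; fin_cases i <;> fin_cases j <;> simp [alphaSO7] <;> ring

/-- The real subspace `{alphaSO7 t : t ∈ ℝ}`, for the pair `(SO(7, ℂ), G₂(ℂ))`. -/
noncomputable def aSO7 : Submodule ℝ Mat8 where
  carrier := {X | ∃ t : ℝ, X = alphaSO7 t}
  zero_mem' := ⟨0, by rw [alphaSO7_eq_smul]; simp⟩
  add_mem' := by
    rintro _ _ ⟨s, rfl⟩ ⟨t, rfl⟩
    refine ⟨s + t, ?_⟩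
    rw [alphaSO7_eq_smul s, alphaSO7_eq_smul t, alphaSO7_eq_smul ((s + t : ℝ) : ℂ), Complex.ofReal_add, add_smul]
  smul_mem' := by
    rintro c _ ⟨t, rfl⟩
    refine ⟨c * t, ?_⟩
    rw [alphaSO7_eq_smul t, alphaSO7_eq_smul ((c * t : ℝ) : ℂ), Complex.ofReal_mul, mul_smul]
    rfl

theorem alphaSpin7_eq_smul (t : ℂ) : alphaSpin7 t = t • alphaSpin7 1 := by
  ext i j; fin_cases i <;> fin_cases j <;> simp [alphaSpin7] <;> ring

/-- The real subspace `{alphaSpin7 t : t ∈ ℝ}`, for the pair `(Spin(7, ℂ), G₂(ℂ))`. -/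
noncomputable def aSpin7 : Submodule ℝ Mat8 where
  carrier := {X | ∃ t : ℝ, X = alphaSpin7 t}
  zero_mem' := ⟨0, by rw [alphaSpin7_eq_smul]; simp⟩
  add_mem' := by
    rintro _ _ ⟨s, rfl⟩ ⟨t, rfl⟩
    refine ⟨s + t, ?_⟩
    rw [alphaSpin7_eq_smul s, alphaSpin7_eq_smul t, alphaSpin7_eq_smul ((s + t : ℝ) : ℂ), Complex.ofReal_add, add_smul]
  smul_mem' := by
    rintro c _ ⟨t, rfl⟩
    refine ⟨c * t, ?_⟩
    rw [alphaSpin7_eq_smul t, alphaSpin7_eq_smul ((c * t : ℝ) : ℂ), Complex.ofReal_mul, mul_smul]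
    rfl

theorem tauG2_eq_smul (t : ℂ) : tauG2 t = t • tauG2 1 := by
  ext i j; fin_cases i <;> fin_cases j <;> simp [tauG2] <;> ring

/-- The real subspace `{tauG2 t : t ∈ ℝ}`, for the pair `(G₂(ℂ), SL(3, ℂ))`. -/
noncomputable def aG2 : Submodule ℝ Mat8 where
  carrier := {X | ∃ t : ℝ, X = tauG2 t}
  zero_mem' := ⟨0, by rw [tauG2_eq_smul]; simp⟩
  add_mem' := by
    rintro _ _ ⟨s, rfl⟩ ⟨t, rfl⟩
    refine ⟨s + t, ?_⟩
    rw [tauG2_eq_smul s, tauG2_eq_smul t, tauG2_eq_smul ((s + t : ℝ) : ℂ), Complex.ofReal_add, add_smul]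
  smul_mem' := by
    rintro c _ ⟨t, rfl⟩
    refine ⟨c * t, ?_⟩
    rw [tauG2_eq_smul t, tauG2_eq_smul ((c * t : ℝ) : ℂ), Complex.ofReal_mul, mul_smul]
    rfl

end CartanRankOne

namespace CartanRankOne

attribute [local instance] LieRing.ofAssociativeRing

/-! ### Octonion algebra -/

/-! Two of the three quotients are complex spheres. The orbit of `e 0` under `Spin7` lies on z · z =
1 in ℂ⁸ and the stabilizer is `G2`; the orbit of `e 1` under `G2` lies on the same quadric among the
imaginary octonions and the stabilizer is `SL3`. Writing z = x + iy with x, y real, z · z = 1 says x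
⊥ y and |x|² = 1 + |y|², so z = cosh s p + i sinh s q with p, q real orthonormal
(`exists_cosh_sinh`). The real group is transitive on such pairs (`exists_Spin7_pair`,
`exists_G2_pair`), and the one-parameter group moves the base point along exactly this curve with
the standard pair. Hence k exp(sA) and g agree on the base point, and they differ by an element of
H.

Transitivity rests on left multiplications by imaginary unit octonions, which lie in `Spin7`
(`exists_leftMul_related`), and on the involutive automorphisms attached to quaternion subalgebras,
which are products of three of them (`exists_G2_involution`).

The pair (`SO7`, `G2`) is deduced from (`Spin7`, `G2`) through the vector representation g ↦ g₀. It
is onto by a Cartan–Dieudonné argument (`exists_related_of_mem_SO7`), is the identity on `G2`,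
preserves reality, and carries `expSpin7 t` to `expSO7 (2 * t / 3)`.

Killing orthogonality comes from averaging, by invariance of the form. Over `G2`, the generator A is
fixed by a group of 12 automorphisms whose average kills Lie `G2`. Over `SL3`, it is Y that is
fixed, by the centre of `SL3`, whose average kills A.

For a general θ_u preserving H, decompose u⁻¹ = k exp(tA) h. Preservation of H makes exp(2tA)
conjugate H into itself, and this forces t = 0 (the `eq_zero_of_normalize` lemmas). So u = vk' with
v ∈ H and k' real, θ_u = θ_v, and conjugation by v carries the decomposition for θ₁ to one for θ_u,
with 𝔞 = Ad(v) 𝔞₀. -/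

theorem omul_add_left (x x' y : Oct) : omul (x + x') y = omul x y + omul x' y := by
  ext k; fin_cases k <;> simp [omul] <;> ring

theorem omul_add_right (x y y' : Oct) : omul x (y + y') = omul x y + omul x y' := by
  ext k; fin_cases k <;> simp [omul] <;> ring

theorem omul_smul_left (c : ℂ) (x y : Oct) : omul (c • x) y = c • omul x y := by
  ext k; fin_cases k <;> simp [omul] <;> ring

theorem omul_smul_right (c : ℂ) (x y : Oct) : omul x (c • y) = c • omul x y := by
  ext k; fin_cases k <;> simp [omul] <;> ring

theorem omul_neg_left (x y : Oct) : omul (-x) y = -omul x y := by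
  rw [← neg_one_smul ℂ x, omul_smul_left, neg_one_smul]

theorem omul_neg_right (x y : Oct) : omul x (-y) = -omul x y := by
  rw [← neg_one_smul ℂ y, omul_smul_right, neg_one_smul]

theorem omul_sub_right (x y y' : Oct) : omul x (y - y') = omul x y - omul x y' := by
  rw [sub_eq_add_neg, omul_add_right, omul_neg_right, ← sub_eq_add_neg]

theorem omul_sub_left (x x' y : Oct) : omul (x - x') y = omul x y - omul x' y := by
  rw [sub_eq_add_neg, omul_add_left, omul_neg_left, ← sub_eq_add_neg]

theorem e_dotProduct (i : Fin 8) (x : Oct) : e i ⬝ᵥ x = x i := by simp [e]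

theorem dotProduct_e (i : Fin 8) (x : Oct) : x ⬝ᵥ e i = x i := by simp [e]

theorem omul_dotProduct_self (x y : Oct) :
    omul x y ⬝ᵥ omul x y = (x ⬝ᵥ x) * (y ⬝ᵥ y) := by
  simpa only [dotProduct, sq] using omul_norm x y

theorem omul_apply_zero (x y : Oct) (hx : x 0 = 0) : omul x y 0 = -(x ⬝ᵥ y) := by
  simp [omul, dotProduct, Fin.sum_univ_eight, hx]; ring

theorem omul_omul_self_left (a y : Oct) (ha : a 0 = 0) :
    omul a (omul a y) = -(a ⬝ᵥ a) • y := by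
  ext k; fin_cases k <;> simp [omul, dotProduct, Fin.sum_univ_eight, ha] <;> ring

theorem omul_omul_self_right (x a : Oct) (ha : a 0 = 0) :
    omul (omul x a) a = -(a ⬝ᵥ a) • x := by
  ext k; fin_cases k <;> simp [omul, dotProduct, Fin.sum_univ_eight, ha] <;> ring

theorem omul_self_imaginary (a : Oct) (ha : a 0 = 0) : omul a a = -(a ⬝ᵥ a) • e 0 := by
  have h := omul_omul_self_left a (e 0) ha
  rwa [(omul_unit a).2] at h

theorem omul_swap_imaginary (x y : Oct) (hx : x 0 = 0) (hy : y 0 = 0) :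
    omul x y = -omul y x - (2 * (x ⬝ᵥ y)) • e 0 := by
  have h := omul_anticomm x y hx hy
  rw [eq_sub_of_add_eq h, dotProduct]
  module

theorem omul_dotProduct_left (a x y : Oct) (ha : a 0 = 0) :
    omul a x ⬝ᵥ y = -(x ⬝ᵥ omul a y) := by
  simp [omul, dotProduct, Fin.sum_univ_eight, ha]; ring

theorem omul_dotProduct_right (a x y : Oct) (ha : a 0 = 0) :
    omul x a ⬝ᵥ y = -(x ⬝ᵥ omul y a) := by
  simp [omul, dotProduct, Fin.sum_univ_eight, ha]; ring

/-- The linearized left alternative law. -/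
theorem omul_left_alternative (a x y : Oct) (ha : a 0 = 0) :
    omul a (omul x y) + omul x (omul a y) = (2 * x 0) • omul a y - (2 * (a ⬝ᵥ x)) • y := by
  ext k; fin_cases k <;> simp [omul, dotProduct, Fin.sum_univ_eight, ha] <;> ring

theorem omul_assoc_imaginary (b c d : Oct) (hb : b 0 = 0) (hc : c 0 = 0) (hd : d 0 = 0) :
    omul b (omul c d) + omul (omul b c) d = (-2 * (c ⬝ᵥ d)) • b + (2 * (b ⬝ᵥ d)) • c
      - (2 * (b ⬝ᵥ c)) • d - (2 * (omul b c ⬝ᵥ d)) • e 0 := by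
  ext k; fin_cases k <;> simp [omul, dotProduct, Fin.sum_univ_eight, hb, hc, hd, e] <;> ring

/-! ### Left multiplications as elements of `Spin(7, ℂ)` -/

/-- The matrix of left multiplication by `a`. -/
def leftMul (a : Oct) : Mat8 := Matrix.of fun i j => omul a (e j) i

theorem leftMul_mulVec (a x : Oct) : leftMul a *ᵥ x = omul a x := by
  ext k
  fin_cases k <;> simp [leftMul, mulVec, dotProduct, Fin.sum_univ_eight, omul, e] <;> ring

/-- The matrix of right multiplication by `a`. -/
def rightMul (a : Oct) : Mat8 := Matrix.of fun i j => omul (e j) a i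

theorem rightMul_mulVec (a x : Oct) : rightMul a *ᵥ x = omul x a := by
  ext k
  fin_cases k <;> simp [rightMul, mulVec, dotProduct, Fin.sum_univ_eight, omul, e] <;> ring

theorem ext_mulVec {M N : Mat8} (h : ∀ x : Oct, M *ᵥ x = N *ᵥ x) : M = N :=
  Matrix.mulVec_injective (funext h)

theorem leftMul_transpose (a : Oct) (ha : a 0 = 0) : (leftMul a)ᵀ = -leftMul a := by
  ext i j
  have h := omul_dotProduct_left a (e i) (e j) ha
  rwa [dotProduct_e, e_dotProduct] at h

theorem rightMul_transpose (a : Oct) (ha : a 0 = 0) : (rightMul a)ᵀ = -rightMul a := by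
  ext i j
  have h := omul_dotProduct_right a (e i) (e j) ha
  rwa [dotProduct_e, e_dotProduct] at h

theorem leftMul_mul_self (a : Oct) (ha : a 0 = 0) (h1 : a ⬝ᵥ a = 1) :
    leftMul a * leftMul a = -1 := by
  apply ext_mulVec
  intro x
  rw [← mulVec_mulVec, leftMul_mulVec, leftMul_mulVec, omul_omul_self_left a x ha, h1]
  simp [neg_mulVec]

theorem rightMul_mul_self (a : Oct) (ha : a 0 = 0) (h1 : a ⬝ᵥ a = 1) :
    rightMul a * rightMul a = -1 := by
  apply ext_mulVec
  intro x
  rw [← mulVec_mulVec, rightMul_mulVec, rightMul_mulVec, omul_omul_self_right x a ha, h1]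
  simp [neg_mulVec]

/-- A skew complex structure on `ℂ⁸` is orthogonal of determinant one. -/
theorem det_eq_one_of_skew {J : Mat8} (hT : Jᵀ = -J) (hJ : J * J = -1) : J.det = 1 := by
  -- Both ᵗ(1 + J)(1 + J) = 2 and (1 + J)² = 2J have determinant det(1 + J)²; comparing them gives
  -- det J = 1.
  have h1 : (1 + J)ᵀ * (1 + J) = (2 : ℂ) • 1 := by
    rw [transpose_add, hT, transpose_one]
    have : (1 + -J) * (1 + J) = 1 - J * J := by noncomm_ring
    rw [this, hJ, two_smul, sub_neg_eq_add]
  have h2 : (1 + J) * (1 + J) = (2 : ℂ) • J := by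
    have : (1 + J) * (1 + J) = 1 + J * J + (J + J) := by noncomm_ring
    rw [this, hJ, two_smul]; abel
  have d1 := congrArg det h1
  have d2 := congrArg det h2
  rw [det_mul, det_transpose, det_smul, det_one] at d1
  rw [det_mul, det_smul, d1] at d2
  simpa using d2.symm

theorem orthogonal_of_skew {J : Mat8} (hT : Jᵀ = -J) (hJ : J * J = -1) : Jᵀ * J = 1 := by
  rw [hT, neg_mul, hJ, neg_neg]

/-- The relation `(g₀ x)(g y) = g (x y)` for all `x` and `y`. -/
def Related (g₀ g : SL8) : Prop := ∀ x y : Oct,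
  omul ((g₀ : Mat8) *ᵥ x) ((g : Mat8) *ᵥ y) = (g : Mat8) *ᵥ omul x y

theorem Related.mul {a₀ a b₀ b : SL8} (ha : Related a₀ a) (hb : Related b₀ b) :
    Related (a₀ * b₀) (a * b) := fun x y => by
  simp only [Matrix.SpecialLinearGroup.coe_mul, ← Matrix.mulVec_mulVec, ha _ _, hb _ _]

/-- Take y = g⁻¹ e₀ in the relation. The formula recovers g₀ from g, which is what makes the vector
representation well defined. -/
theorem Related.apply {g₀ g : SL8} (h : Related g₀ g) (x : Oct) :
    (g₀ : Mat8) *ᵥ x = (g : Mat8) *ᵥ omul x (((g⁻¹ : SL8) : Mat8) *ᵥ e 0) := by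
  rw [← h, mulVec_inv_mulVec, (omul_unit _).2]

theorem Related.unique {g₀ g₁ g : SL8} (h : Related g₀ g) (h' : Related g₁ g) : g₀ = g₁ :=
  Subtype.ext (ext_mulVec fun x => by rw [h.apply, h'.apply])

theorem Related.inv {g₀ g : SL8} (h : Related g₀ g) : Related g₀⁻¹ g⁻¹ := fun x y => by
  have h := h (((g₀⁻¹ : SL8) : Mat8) *ᵥ x) (((g⁻¹ : SL8) : Mat8) *ᵥ y)
  rw [mulVec_inv_mulVec, mulVec_inv_mulVec] at h
  rw [h, inv_mulVec_mulVec]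

theorem mem_SO8_iff {g : SL8} : g ∈ SO8 ↔ (g : Mat8)ᵀ * (g : Mat8) = 1 := Iff.rfl

/-- Taking y = e₀ in the relation gives g₀ = g. Thus `G2` is the stabilizer of `e 0` in `Spin7`. -/
theorem mem_G2_of_related {g₀ g : SL8} (hg : g ∈ SO8) (h : Related g₀ g)
    (h0 : (g : Mat8) *ᵥ e 0 = e 0) : g ∈ G2 := by
  refine ⟨hg, ?_⟩
  have : g₀ = g := Subtype.ext (ext_mulVec fun x => by
    have := h x (e 0)
    rwa [h0, (omul_unit _).2, (omul_unit _).2] at this)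
  rwa [this] at h

theorem mulVec_e_zero_of_mem_G2 {g : SL8} (hg : g ∈ G2) : (g : Mat8) *ᵥ e 0 = e 0 := by
  have h := hg.2 (e 0) (((g⁻¹ : SL8) : Mat8) *ᵥ e 0)
  rwa [mulVec_inv_mulVec, (omul_unit _).1, mulVec_inv_mulVec, (omul_unit _).2] at h

theorem G2_le_SO7 : G2 ≤ SO7 := fun _ hg => ⟨hg.1, mulVec_e_zero_of_mem_G2 hg⟩

theorem G2_le_Spin7 : G2 ≤ Spin7 := fun g hg => ⟨hg.1, g, G2_le_SO7 hg, hg.2⟩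

theorem SL3_le_G2 : SL3 ≤ G2 := fun _ hg => hg.1

theorem dotProduct_mulVec_of_mem_SO8 {g : SL8} (hg : g ∈ SO8) (x y : Oct) :
    ((g : Mat8) *ᵥ x) ⬝ᵥ ((g : Mat8) *ᵥ y) = x ⬝ᵥ y := by
  rw [mem_SO8_iff] at hg
  rw [dotProduct_mulVec, ← mulVec_transpose, mulVec_mulVec, hg, one_mulVec]

/-- For an imaginary unit vector `a`, the matrix of `x ↦ -a x a`. -/
def twist (a : Oct) : Mat8 := -(leftMul a * rightMul a)

theorem twist_mulVec (a x : Oct) (ha : a 0 = 0) (h1 : a ⬝ᵥ a = 1) :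
    twist a *ᵥ x = (2 * (a ⬝ᵥ x)) • a - x + (2 * x 0) • e 0 := by
  have h := omul_left_alternative a x a ha
  rw [omul_self_imaginary a ha, h1, omul_smul_right, (omul_unit x).2] at h
  rw [twist, neg_mulVec, ← mulVec_mulVec, rightMul_mulVec, leftMul_mulVec,
    eq_sub_of_add_eq h]
  module

/-- The relation (−a x a)(a y) = a (x y) is the linearized left alternative law, once −a x a is
expanded. On imaginary vectors `twist a` is the half-turn about the axis a, so it has determinant
one there. These pairs supply all elements of `Spin7` built by hand below. -/
theorem exists_leftMul_related (a : Oct) (ha : a 0 = 0) (h1 : a ⬝ᵥ a = 1) :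
    ∃ g ∈ Spin7, ∃ g₀ ∈ SO7, (g : Mat8) = leftMul a ∧ (g₀ : Mat8) = twist a ∧ Related g₀ g := by
  have hL := leftMul_mul_self a ha h1
  have hLT := leftMul_transpose a ha
  have hR := rightMul_mul_self a ha h1
  have hRT := rightMul_transpose a ha
  have hdet : (twist a).det = 1 := by
    rw [twist, det_neg, det_mul, det_eq_one_of_skew hLT hL, det_eq_one_of_skew hRT hR]
    norm_num
  have horth : (twist a)ᵀ * twist a = 1 := by
    rw [twist, transpose_neg, transpose_mul, neg_mul_neg, Matrix.mul_assoc,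
      ← Matrix.mul_assoc _ (leftMul a), orthogonal_of_skew hLT hL, Matrix.one_mul,
      orthogonal_of_skew hRT hR]
  have h0 : (⟨twist a, hdet⟩ : SL8) ∈ SO7 := by
    refine ⟨horth, ?_⟩
    change twist a *ᵥ e 0 = e 0
    rw [twist_mulVec a _ ha h1, dotProduct_e, ha]
    simp only [e, Pi.single_eq_same]
    module
  have hrel : Related ⟨twist a, hdet⟩ ⟨leftMul a, det_eq_one_of_skew hLT hL⟩ := by
    intro x y
    change omul (twist a *ᵥ x) (leftMul a *ᵥ y) = leftMul a *ᵥ omul x y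
    rw [twist_mulVec a _ ha h1, leftMul_mulVec, leftMul_mulVec]
    simp only [omul_add_left, omul_sub_left, omul_smul_left, omul_omul_self_left a y ha, h1,
      (omul_unit _).1]
    rw [eq_sub_of_add_eq (omul_left_alternative a x y ha)]
    module
  exact ⟨⟨leftMul a, det_eq_one_of_skew hLT hL⟩, ⟨orthogonal_of_skew hLT hL, _, h0, hrel⟩, _, h0,
    rfl, rfl, hrel⟩

/-! ### Real vectors and real group elements -/

theorem star_e (i : Fin 8) : star (e i) = e i := by
  ext k; by_cases h : k = i <;> simp [e, h]

theorem star_omul (x y : Oct) : star (omul x y) = omul (star x) (star y) := by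
  ext k; fin_cases k <;> simp [omul]

theorem star_dotProduct_real {x y : Oct} (hx : star x = x) (hy : star y = y) :
    star (x ⬝ᵥ y) = x ⬝ᵥ y := by
  rw [← Matrix.star_dotProduct_star, hx, hy, dotProduct_comm]

theorem star_mulVec_map (M : Mat8) (x : Oct) :
    star (M *ᵥ x) = M.map (starRingEnd ℂ) *ᵥ star x := by
  ext k; simp [mulVec, dotProduct]

theorem coe_conjSL (g : SL8) : (conjSL g : Mat8) = (g : Mat8).map (starRingEnd ℂ) := rfl

theorem star_mulVec_conjSL (g : SL8) (x : Oct) :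
    star ((g : Mat8) *ᵥ x) = (conjSL g : Mat8) *ᵥ star x := star_mulVec_map _ _

theorem conjSL_conjSL (g : SL8) : conjSL (conjSL g) = g := by
  ext i j; simp [coe_conjSL]

theorem conjSL_mulVec (g : SL8) (x : Oct) :
    (conjSL g : Mat8) *ᵥ x = star ((g : Mat8) *ᵥ star x) := by
  rw [star_mulVec_conjSL, star_star]

/-- Since conjugation respects the octonion product, this criterion makes products of
multiplications by real octonions visibly real. -/
theorem conjSL_eq_self_iff {g : SL8} :
    conjSL g = g ↔ ∀ x : Oct, star x = x → star ((g : Mat8) *ᵥ x) = (g : Mat8) *ᵥ x := by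
  constructor
  · intro h x hx
    rw [star_mulVec_conjSL, h, hx]
  · intro h
    apply Subtype.ext
    apply Matrix.ext_of_mulVec_single
    intro i
    have := h (e i) (star_e i)
    rwa [star_mulVec_conjSL, star_e] at this

theorem conjSL_mem_SO8 {g : SL8} (hg : g ∈ SO8) : conjSL g ∈ SO8 := by
  rw [mem_SO8_iff] at hg ⊢
  rw [coe_conjSL, ← transpose_map, ← Matrix.map_mul, hg]
  simp

theorem Related.conjSL {g₀ g : SL8} (h : Related g₀ g) : Related (conjSL g₀) (conjSL g) := by
  intro x y
  rw [conjSL_mulVec, conjSL_mulVec, conjSL_mulVec, ← star_omul, h, star_omul]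

theorem conjSL_mem_G2 {g : SL8} (hg : g ∈ G2) : conjSL g ∈ G2 :=
  ⟨conjSL_mem_SO8 hg.1, Related.conjSL hg.2⟩

theorem conjSL_mem_SL3 {g : SL8} (hg : g ∈ SL3) : conjSL g ∈ SL3 := by
  refine ⟨conjSL_mem_G2 hg.1, ?_⟩
  rw [conjSL_mulVec, star_e, hg.2, star_e]

/-! ### Real unit vectors and transitivity of the compact groups -/

theorem dotProduct_self_eq_sum_normSq {x : Oct} (hx : star x = x) :
    x ⬝ᵥ x = ((∑ i, normSq (x i) : ℝ) : ℂ) := by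
  rw [dotProduct, ofReal_sum]
  refine Finset.sum_congr rfl fun i _ => ?_
  have : (starRingEnd ℂ) (x i) = x i := congrFun hx i
  rw [normSq_eq_conj_mul_self, this]

/-- A nonzero real vector can be normalized. -/
theorem exists_normalize {x : Oct} (hx : star x = x) (h0 : x ≠ 0) :
    ∃ r : ℂ, r ≠ 0 ∧ star (r • x) = r • x ∧ (r • x) ⬝ᵥ (r • x) = 1 := by
  have hpos : 0 < ∑ i, normSq (x i) := by
    obtain ⟨i, hi⟩ := Function.ne_iff.mp h0
    exact Finset.sum_pos' (fun i _ => normSq_nonneg _) ⟨i, Finset.mem_univ _, normSq_pos.mpr hi⟩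
  set N := ∑ i, normSq (x i) with hN
  refine ⟨((√N)⁻¹ : ℝ), ?_, ?_, ?_⟩
  · have := (inv_pos.mpr (Real.sqrt_pos.mpr hpos)).ne'
    exact_mod_cast this
  · rw [star_smul, hx, ← starRingEnd_apply, conj_ofReal]
  · rw [smul_dotProduct, dotProduct_smul, dotProduct_self_eq_sum_normSq hx, ← hN, smul_eq_mul,
      smul_eq_mul, ← mul_assoc, ← ofReal_mul, ← ofReal_mul, ← mul_inv, Real.mul_self_sqrt hpos.le,
      inv_mul_cancel₀ hpos.ne', ofReal_one]

/-- There is a real unit vector orthogonal to at most seven given real vectors. -/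
theorem exists_unit_orthogonal {n : ℕ} (hn : n < 8) (w : Fin n → Oct)
    (hw : ∀ i, star (w i) = w i) :
    ∃ c : Oct, star c = c ∧ c ⬝ᵥ c = 1 ∧ ∀ i, w i ⬝ᵥ c = 0 := by
  let A : Matrix (Fin n) (Fin 8) ℝ := Matrix.of fun i j => (w i j).re
  have hker : LinearMap.ker A.mulVecLin ≠ ⊥ :=
    LinearMap.ker_ne_bot_of_finrank_lt (by simpa using hn)
  obtain ⟨v, hv, hv0⟩ := Submodule.exists_mem_ne_zero_of_ne_bot hker
  let x : Oct := fun i => (v i : ℂ)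
  have hx : star x = x := by ext i; simp [x]
  have hx0 : x ≠ 0 := fun h => hv0 (by ext i; simpa [x] using congrFun h i)
  obtain ⟨r, -, h1, h2⟩ := exists_normalize hx hx0
  refine ⟨r • x, h1, h2, fun i => ?_⟩
  rw [dotProduct_smul]
  have : A i ⬝ᵥ v = 0 := congrFun hv i
  have h3 : w i ⬝ᵥ x = ((A i ⬝ᵥ v : ℝ) : ℂ) := by
    simp only [dotProduct, ofReal_sum, ofReal_mul, A, x, Matrix.of_apply]
    refine Finset.sum_congr rfl fun j _ => ?_
    rw [conj_eq_iff_re.mp (congrFun (hw i) j)]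
  rw [h3, this, ofReal_zero, smul_zero]

/-- The involutive automorphism fixing a quaternion subalgebra and negating its orthogonal
complement. -/
theorem exists_G2_involution {b c : Oct} (hb : star b = b) (hc : star c = c) (hb0 : b 0 = 0)
    (hc0 : c 0 = 0) (hb1 : b ⬝ᵥ b = 1) (hc1 : c ⬝ᵥ c = 1) (hbc : b ⬝ᵥ c = 0) :
    ∃ g ∈ G2, conjSL g = g ∧ (g : Mat8) *ᵥ b = b ∧ (g : Mat8) *ᵥ c = c ∧
      ∀ d : Oct, d 0 = 0 → b ⬝ᵥ d = 0 → c ⬝ᵥ d = 0 → omul b c ⬝ᵥ d = 0 →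
        (g : Mat8) *ᵥ d = -d := by
  have hswap : omul c b = -omul b c := by
    rw [omul_swap_imaginary c b hc0 hb0, dotProduct_comm, hbc]; simp
  have hcb0 : omul c b 0 = 0 := by rw [omul_apply_zero c b hc0, dotProduct_comm, hbc, neg_zero]
  have hcb1 : omul c b ⬝ᵥ omul c b = 1 := by rw [omul_dotProduct_self, hb1, hc1, one_mul]
  -- The involution is x ↦ (cb)(b(cx)). On the quaternion algebra of b and c, associativity gives
  -- (cb)(bc) = 1. On its orthogonal complement b(cd) = (cb)d, and (cb)² = −1 yields −d. The product
  -- lies in `Spin7` and fixes `e 0`, hence lies in `G2`.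
  obtain ⟨g₁, ⟨hs₁, -⟩, k₁, -, h₁, -, hr₁⟩ := exists_leftMul_related (omul c b) hcb0 hcb1
  obtain ⟨g₂, ⟨hs₂, -⟩, k₂, -, h₂, -, hr₂⟩ := exists_leftMul_related b hb0 hb1
  obtain ⟨g₃, ⟨hs₃, -⟩, k₃, -, h₃, -, hr₃⟩ := exists_leftMul_related c hc0 hc1
  have happ : ∀ x : Oct, ((g₁ * g₂ * g₃ : SL8) : Mat8) *ᵥ x =
      omul (omul c b) (omul b (omul c x)) := by
    intro x
    rw [Matrix.SpecialLinearGroup.coe_mul, Matrix.SpecialLinearGroup.coe_mul, ← mulVec_mulVec,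
      ← mulVec_mulVec, h₁, h₂, h₃, leftMul_mulVec, leftMul_mulVec, leftMul_mulVec]
  have hbb : ∀ x, omul b (omul b x) = -x := fun x => by
    rw [omul_omul_self_left b x hb0, hb1]; module
  have hcc : ∀ x, omul c (omul c x) = -x := fun x => by
    rw [omul_omul_self_left c x hc0, hc1]; module
  have hcbcb : ∀ x, omul (omul c b) (omul (omul c b) x) = -x := fun x => by
    rw [omul_omul_self_left _ x hcb0, hcb1]; module
  have hbr : ∀ x, omul (omul x b) b = -x := fun x => by
    rw [omul_omul_self_right x b hb0, hb1]; module
  have hcr : ∀ x, omul (omul x c) c = -x := fun x => by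
    rw [omul_omul_self_right x c hc0, hc1]; module
  refine ⟨g₁ * g₂ * g₃, mem_G2_of_related (mul_mem (mul_mem hs₁ hs₂) hs₃)
    ((hr₁.mul hr₂).mul hr₃) ?_, ?_, ?_, ?_, ?_⟩
  · rw [happ, (omul_unit c).2, ← neg_neg (omul b c), ← hswap, omul_neg_right,
      omul_self_imaginary _ hcb0, hcb1]
    module
  · rw [conjSL_eq_self_iff]
    intro x hx
    rw [happ, star_omul, star_omul, star_omul, star_omul, hx, hb, hc]
  · have h1 : omul b (omul c b) = c := by rw [hswap, omul_neg_right, hbb, neg_neg]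
    rw [happ, h1, hswap, omul_neg_left, hcr, neg_neg]
  · rw [happ, omul_self_imaginary c hc0, hc1, neg_one_smul, omul_neg_right, omul_neg_right,
      (omul_unit b).2, hbr, neg_neg]
  · intro d hd0 hbd hcd hbcd
    have h := omul_assoc_imaginary b c d hb0 hc0 hd0
    rw [hbd, hcd, hbc, hbcd] at h
    have h' : omul b (omul c d) = omul (omul c b) d := by
      rw [hswap, omul_neg_left, eq_neg_iff_add_eq_zero, h]; simp
    rw [happ, h', hcbcb]

/-- If `p ⊥ r q`, an involution in the stabilizer of `r` in the compact group `G₂` maps `p` to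
`q`. -/
theorem exists_G2_swap {r p q : Oct} (hr : star r = r) (hp : star p = p) (hq : star q = q)
    (hr0 : r 0 = 0) (hp0 : p 0 = 0) (hq0 : q 0 = 0) (hr1 : r ⬝ᵥ r = 1) (hpq : p ⬝ᵥ p = q ⬝ᵥ q)
    (hrp : r ⬝ᵥ p = 0) (hrq : r ⬝ᵥ q = 0) (hprq : p ⬝ᵥ omul r q = 0) :
    ∃ g ∈ G2, conjSL g = g ∧ (g : Mat8) *ᵥ r = r ∧ (g : Mat8) *ᵥ p = q := by
  have hd : star (p - q) = p - q := by rw [star_sub, hp, hq]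
  have hd0 : (p - q) 0 = 0 := by rw [Pi.sub_apply, hp0, hq0, sub_zero]
  have hrd : r ⬝ᵥ (p - q) = 0 := by rw [dotProduct_sub, hrp, hrq, sub_zero]
  -- An involution fixing p + q and negating p − q swaps p and q. So c should span p + q, with p − q
  -- orthogonal to the quaternion algebra of r and c. For c proportional to p + q, the condition rc
  -- ⊥ p − q is where p ⊥ rq enters; if p + q = 0, any c satisfying the orthogonality conditions
  -- will do.
  suffices H : ∃ c : Oct, star c = c ∧ c 0 = 0 ∧ c ⬝ᵥ c = 1 ∧ r ⬝ᵥ c = 0 ∧ c ⬝ᵥ (p - q) = 0 ∧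
      omul r c ⬝ᵥ (p - q) = 0 ∧ ∃ s : ℂ, p + q = s • c by
    obtain ⟨c, hc, hc0, hc1, hrc, hcd, hrcd, s, hs⟩ := H
    obtain ⟨g, hg, hgc, hgr, hgc', hgd⟩ := exists_G2_involution hr hc hr0 hc0 hr1 hc1 hrc
    refine ⟨g, hg, hgc, hgr, ?_⟩
    have h1 : (g : Mat8) *ᵥ (p + q) = p + q := by rw [hs, mulVec_smul, hgc']
    have h2 := hgd (p - q) hd0 hrd hcd hrcd
    have h3 : p = (2⁻¹ : ℂ) • ((p + q) + (p - q)) := by module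
    rw [h3, mulVec_smul, mulVec_add, h1, h2]
    module
  by_cases hs : p + q = 0
  · obtain ⟨c, hc, hc1, hw⟩ := exists_unit_orthogonal (n := 4) (by norm_num)
      ![e 0, r, p - q, omul r (p - q)] (by
        intro i
        fin_cases i
        · exact star_e 0
        · exact hr
        · exact hd
        · change star (omul r (p - q)) = omul r (p - q)
          rw [star_omul, hr, hd])
    have w0 : e 0 ⬝ᵥ c = 0 := hw 0
    have w1 : r ⬝ᵥ c = 0 := hw 1
    have w2 : (p - q) ⬝ᵥ c = 0 := hw 2
    have w3 : omul r (p - q) ⬝ᵥ c = 0 := hw 3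
    rw [e_dotProduct] at w0
    refine ⟨c, hc, w0, hc1, w1, by rwa [dotProduct_comm], ?_, 0, by rw [hs, zero_smul]⟩
    rw [omul_dotProduct_left r _ _ hr0, dotProduct_comm, w3, neg_zero]
  · have hst : star (p + q) = p + q := by rw [star_add, hp, hq]
    obtain ⟨s, hs0, h1, h2⟩ := exists_normalize hst hs
    refine ⟨s • (p + q), h1, ?_, h2, ?_, ?_, ?_, s⁻¹, by rw [inv_smul_smul₀ hs0]⟩
    · simp [hp0, hq0]
    · rw [dotProduct_smul, dotProduct_add, hrp, hrq]; simp
    · rw [smul_dotProduct, dotProduct_sub, add_dotProduct, add_dotProduct, hpq,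
        dotProduct_comm p q]
      ring
    · have e1 : omul r p ⬝ᵥ p = 0 := by
        have := omul_dotProduct_left r p p hr0
        rw [dotProduct_comm p] at this
        linear_combination this / 2
      have e2 : omul r q ⬝ᵥ q = 0 := by
        have := omul_dotProduct_left r q q hr0
        rw [dotProduct_comm q] at this
        linear_combination this / 2
      have e3 : omul r q ⬝ᵥ p = 0 := by rwa [dotProduct_comm]
      have e4 : omul r p ⬝ᵥ q = 0 := by
        rw [omul_dotProduct_left r p q hr0, hprq, neg_zero]
      rw [omul_smul_right, omul_add_right, smul_dotProduct, dotProduct_sub, add_dotProduct,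
        add_dotProduct, e1, e2, e3, e4]
      simp

/-- A unit imaginary vector m orthogonal to r, rp and rq can be swapped both with p and with q, so
two involutions carry p to q through m. This is the transitivity of the compact SU(3) on S⁵. -/
theorem exists_G2_stabilizer {r p q : Oct} (hr : star r = r) (hp : star p = p) (hq : star q = q)
    (hr0 : r 0 = 0) (hp0 : p 0 = 0) (hq0 : q 0 = 0) (hr1 : r ⬝ᵥ r = 1) (hp1 : p ⬝ᵥ p = 1)
    (hq1 : q ⬝ᵥ q = 1) (hrp : r ⬝ᵥ p = 0) (hrq : r ⬝ᵥ q = 0) :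
    ∃ g ∈ G2, conjSL g = g ∧ (g : Mat8) *ᵥ r = r ∧ (g : Mat8) *ᵥ p = q := by
  obtain ⟨m, hm, hm1, hw⟩ := exists_unit_orthogonal (n := 4) (by norm_num)
    ![e 0, r, omul r p, omul r q] (by
      intro i
      fin_cases i
      · exact star_e 0
      · exact hr
      · change star (omul r p) = omul r p
        rw [star_omul, hr, hp]
      · change star (omul r q) = omul r q
        rw [star_omul, hr, hq])
  have w0 : e 0 ⬝ᵥ m = 0 := hw 0
  have w1 : r ⬝ᵥ m = 0 := hw 1
  have w2 : omul r p ⬝ᵥ m = 0 := hw 2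
  have w3 : omul r q ⬝ᵥ m = 0 := hw 3
  rw [e_dotProduct] at w0
  obtain ⟨g, hg, hgc, hgr, hgp⟩ := exists_G2_swap hr hp hm hr0 hp0 w0 hr1 (by rw [hp1, hm1]) hrp w1
    (by rw [← neg_eq_zero, ← omul_dotProduct_left r p m hr0, w2])
  obtain ⟨k, hk, hkc, hkr, hkm⟩ := exists_G2_swap hr hm hq hr0 w0 hq0 hr1 (by rw [hq1, hm1]) w1 hrq
    (by rw [dotProduct_comm, w3])
  refine ⟨k * g, mul_mem hk hg, by rw [map_mul, hgc, hkc], ?_, ?_⟩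
  · rw [Matrix.SpecialLinearGroup.coe_mul, ← mulVec_mulVec, hgr, hkr]
  · rw [Matrix.SpecialLinearGroup.coe_mul, ← mulVec_mulVec, hgp, hkm]

/-- Any imaginary unit vector r orthogonal to p and q reduces this to the stabilizer of r. -/
theorem exists_G2_sphere {p q : Oct} (hp : star p = p) (hq : star q = q)
    (hp0 : p 0 = 0) (hq0 : q 0 = 0) (hp1 : p ⬝ᵥ p = 1) (hq1 : q ⬝ᵥ q = 1) :
    ∃ g ∈ G2, conjSL g = g ∧ (g : Mat8) *ᵥ p = q := by
  obtain ⟨r, hr, hr1, hw⟩ := exists_unit_orthogonal (n := 3) (by norm_num) ![e 0, p, q] (by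
      intro i
      fin_cases i
      · exact star_e 0
      · exact hp
      · exact hq)
  have w0 : e 0 ⬝ᵥ r = 0 := hw 0
  have w1 : p ⬝ᵥ r = 0 := hw 1
  have w2 : q ⬝ᵥ r = 0 := hw 2
  rw [e_dotProduct] at w0
  obtain ⟨g, hg, hgc, -, hgp⟩ := exists_G2_stabilizer hr hp hq w0 hp0 hq0 hr1 hp1 hq1
    (by rwa [dotProduct_comm]) (by rwa [dotProduct_comm])
  exact ⟨g, hg, hgc, hgp⟩

/-- The compact group `G₂` is transitive on orthonormal pairs of imaginary octonions. -/
theorem exists_G2_pair {p q p' q' : Oct} (hp : star p = p) (hq : star q = q) (hp' : star p' = p')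
    (hq' : star q' = q') (hp0 : p 0 = 0) (hq0 : q 0 = 0) (hp0' : p' 0 = 0) (hq0' : q' 0 = 0)
    (hp1 : p ⬝ᵥ p = 1) (hq1 : q ⬝ᵥ q = 1) (hp1' : p' ⬝ᵥ p' = 1) (hq1' : q' ⬝ᵥ q' = 1)
    (hpq : p ⬝ᵥ q = 0) (hpq' : p' ⬝ᵥ q' = 0) :
    ∃ g ∈ G2, conjSL g = g ∧ (g : Mat8) *ᵥ p = p' ∧ (g : Mat8) *ᵥ q = q' := by
  obtain ⟨g, hg, hgc, hgp⟩ := exists_G2_sphere hp hp' hp0 hp0' hp1 hp1'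
  have hgq : star ((g : Mat8) *ᵥ q) = (g : Mat8) *ᵥ q := conjSL_eq_self_iff.mp hgc q hq
  have hgq0 : ((g : Mat8) *ᵥ q) 0 = 0 := by
    rw [← e_dotProduct 0 ((g : Mat8) *ᵥ q), ← mulVec_e_zero_of_mem_G2 hg,
      dotProduct_mulVec_of_mem_SO8 hg.1,
      e_dotProduct, hq0]
  have hgq1 : ((g : Mat8) *ᵥ q) ⬝ᵥ ((g : Mat8) *ᵥ q) = 1 := by
    rw [dotProduct_mulVec_of_mem_SO8 hg.1, hq1]
  have hgpq : p' ⬝ᵥ ((g : Mat8) *ᵥ q) = 0 := by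
    rw [← hgp, dotProduct_mulVec_of_mem_SO8 hg.1, hpq]
  obtain ⟨k, hk, hkc, hkp, hkq⟩ := exists_G2_stabilizer hp' hgq hq' hp0' hgq0 hq0' hp1' hgq1 hq1'
    hgpq hpq'
  refine ⟨k * g, mul_mem hk hg, by rw [map_mul, hgc, hkc], ?_, ?_⟩
  · rw [Matrix.SpecialLinearGroup.coe_mul, ← mulVec_mulVec, hgp, hkp]
  · rw [Matrix.SpecialLinearGroup.coe_mul, ← mulVec_mulVec, hkq]

/-- A real unit vector is a product of two imaginary ones: for b imaginary, of length one and
orthogonal to p, the product pb is imaginary and p = −(pb)b. Hence two left multiplications carry `e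
0` to p. -/
theorem exists_Spin7_sphere {p : Oct} (hp : star p = p) (hp1 : p ⬝ᵥ p = 1) :
    ∃ g ∈ Spin7, conjSL g = g ∧ (g : Mat8) *ᵥ e 0 = p := by
  obtain ⟨b, hb, hb1, hw⟩ := exists_unit_orthogonal (n := 2) (by norm_num) ![e 0, p] (by
      intro i
      fin_cases i
      · exact star_e 0
      · exact hp)
  have hb0 : e 0 ⬝ᵥ b = 0 := hw 0
  have hpb : p ⬝ᵥ b = 0 := hw 1
  rw [e_dotProduct] at hb0
  have ha0 : (-omul p b) 0 = 0 := by
    rw [Pi.neg_apply, ← e_dotProduct 0 (omul p b), dotProduct_comm, omul_dotProduct_right b _ _ hb0,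
      (omul_unit b).1, hpb, neg_zero, neg_zero]
  have ha1 : (-omul p b) ⬝ᵥ (-omul p b) = 1 := by
    rw [neg_dotProduct_neg, omul_dotProduct_self, hp1, hb1, one_mul]
  obtain ⟨g, hg, -, -, h, -⟩ := exists_leftMul_related _ ha0 ha1
  obtain ⟨k, hk, -, -, h', -⟩ := exists_leftMul_related _ hb0 hb1
  have happ : ∀ x : Oct, ((g * k : SL8) : Mat8) *ᵥ x = omul (-omul p b) (omul b x) := by
    intro x
    rw [Matrix.SpecialLinearGroup.coe_mul, ← mulVec_mulVec, h, h', leftMul_mulVec, leftMul_mulVec]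
  refine ⟨g * k, mul_mem hg hk, ?_, ?_⟩
  · rw [conjSL_eq_self_iff]
    intro x hx
    rw [happ, star_omul, star_omul, star_neg, star_omul, hp, hb, hx]
  · rw [happ, (omul_unit b).2, omul_neg_left, omul_omul_self_right p b hb0, hb1]
    module

theorem star_mulVec_inv {g : SL8} (hg : conjSL g = g) {x : Oct} (hx : star x = x) :
    star (((g⁻¹ : SL8) : Mat8) *ᵥ x) = ((g⁻¹ : SL8) : Mat8) *ᵥ x :=
  conjSL_eq_self_iff.mp (by rw [map_inv, hg]) x hx

/-- The compact group `Spin(7)` is transitive on orthonormal pairs in `ℝ⁸`. -/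
theorem exists_Spin7_pair {p q : Oct} (hp : star p = p) (hq : star q = q)
    (hp1 : p ⬝ᵥ p = 1) (hq1 : q ⬝ᵥ q = 1) (hpq : p ⬝ᵥ q = 0) :
    ∃ g ∈ Spin7, conjSL g = g ∧ (g : Mat8) *ᵥ e 0 = p ∧ (g : Mat8) *ᵥ e 1 = q := by
  obtain ⟨g, hg, hgc, hgp⟩ := exists_Spin7_sphere hp hp1
  have hgp' : ((g⁻¹ : SL8) : Mat8) *ᵥ p = e 0 := by rw [← hgp, inv_mulVec_mulVec]
  have hi : g⁻¹ ∈ SO8 := inv_mem hg.1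
  -- Pulled back by g, the vector q becomes orthogonal to `e 0`, that is, imaginary; it can then be
  -- reached from `e 1` inside `G2`, which does not disturb `e 0`.
  obtain ⟨k, hk, hkc, hkq⟩ := exists_G2_sphere (p := e 1) (q := ((g⁻¹ : SL8) : Mat8) *ᵥ q)
    (star_e 1) (star_mulVec_inv hgc hq) (by simp [e])
    (by rw [← e_dotProduct 0 (((g⁻¹ : SL8) : Mat8) *ᵥ q), ← hgp',
      dotProduct_mulVec_of_mem_SO8 hi, hpq])
    (by simp [e]) (by rw [dotProduct_mulVec_of_mem_SO8 hi, hq1])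
  refine ⟨g * k, mul_mem hg (G2_le_Spin7 hk), by rw [map_mul, hgc, hkc], ?_, ?_⟩
  · rw [Matrix.SpecialLinearGroup.coe_mul, ← mulVec_mulVec, mulVec_e_zero_of_mem_G2 hk, hgp]
  · rw [Matrix.SpecialLinearGroup.coe_mul, ← mulVec_mulVec, hkq, mulVec_inv_mulVec]

/-- Points of the complex sphere in terms of real orthonormal pairs. -/
theorem exists_cosh_sinh (z : Oct) (hz : z ⬝ᵥ z = 1) :
    ∃ (s : ℝ) (p q : Oct), star p = p ∧ star q = q ∧ p ⬝ᵥ p = 1 ∧ q ⬝ᵥ q = 1 ∧ p ⬝ᵥ q = 0 ∧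
      (z 0 = 0 → p 0 = 0 ∧ q 0 = 0) ∧ z = Complex.cosh s • p + (I * Complex.sinh s) • q := by
  let x : Oct := fun i => ((z i).re : ℂ)
  let y : Oct := fun i => ((z i).im : ℂ)
  have hx : star x = x := by ext i; simp [x]
  have hy : star y = y := by ext i; simp [y]
  have hzxy : z = x + I • y := by
    ext i
    simp only [x, y, Pi.add_apply, Pi.smul_apply, smul_eq_mul]
    rw [mul_comm, re_add_im]
  have hx0 : z 0 = 0 → x 0 = 0 := fun h => by simp [x, h]
  have hy0 : z 0 = 0 → y 0 = 0 := fun h => by simp [y, h]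
  have hxx : ∃ N : ℝ, x ⬝ᵥ x = N := ⟨_, dotProduct_self_eq_sum_normSq hx⟩
  have hyy : ∃ M : ℝ, 0 ≤ M ∧ y ⬝ᵥ y = M :=
    ⟨_, Finset.sum_nonneg fun i _ => normSq_nonneg _, dotProduct_self_eq_sum_normSq hy⟩
  have hxy : ∃ P : ℝ, x ⬝ᵥ y = P :=
    ⟨(x ⬝ᵥ y).re, (conj_eq_iff_re.mp (star_dotProduct_real hx hy)).symm⟩
  obtain ⟨N, hN⟩ := hxx
  obtain ⟨M, hM0, hM⟩ := hyy
  obtain ⟨P, hP⟩ := hxy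
  -- Real and imaginary parts of z · z = 1. They allow s = arsinh √M, with cosh s = √(1 + M).
  have hNM : N = 1 + M ∧ P = 0 := by
    rw [hzxy, add_dotProduct, dotProduct_add, dotProduct_add, smul_dotProduct, smul_dotProduct,
      dotProduct_smul, dotProduct_smul, dotProduct_comm y x, hN, hM, hP] at hz
    have h1 := congrArg re hz
    have h2 := congrArg im hz
    simp at h1 h2
    constructor <;> linarith
  obtain ⟨rfl, rfl⟩ := hNM
  have hNpos : 0 < √(1 + M) := Real.sqrt_pos.mpr (by linarith)
  have hNne : ((√(1 + M) : ℝ) : ℂ) ≠ 0 := by exact_mod_cast hNpos.ne'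
  have hc : Complex.cosh (Real.arsinh √M : ℝ) = ((√(1 + M) : ℝ) : ℂ) := by
    rw [← ofReal_cosh, Real.cosh_arsinh, Real.sq_sqrt hM0]
  have hs : Complex.sinh (Real.arsinh √M : ℝ) = ((√M : ℝ) : ℂ) := by
    rw [← ofReal_sinh, Real.sinh_arsinh]
  have hsq : ((√(1 + M) : ℝ) : ℂ) * ((√(1 + M) : ℝ) : ℂ) = ((1 + M : ℝ) : ℂ) := by
    rw [← ofReal_mul, Real.mul_self_sqrt (by linarith)]
  have hsp : star (((√(1 + M) : ℝ) : ℂ)⁻¹ • x) = ((√(1 + M) : ℝ) : ℂ)⁻¹ • x := by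
    rw [star_smul, hx, ← starRingEnd_apply, map_inv₀, conj_ofReal]
  have hspp : (((√(1 + M) : ℝ) : ℂ)⁻¹ • x) ⬝ᵥ (((√(1 + M) : ℝ) : ℂ)⁻¹ • x) = 1 := by
    rw [smul_dotProduct, dotProduct_smul, hN, ← hsq, smul_eq_mul, smul_eq_mul]
    field_simp
  rcases hM0.eq_or_lt with rfl | hMpos
  · have hyz : y = 0 := by
      rw [dotProduct_self_eq_sum_normSq hy, ofReal_inj,
        Finset.sum_eq_zero_iff_of_nonneg fun i _ => normSq_nonneg _] at hM
      ext i
      exact normSq_eq_zero.mp (hM i (Finset.mem_univ i))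
    -- Here z is real and sinh s = 0, so q is free; it is taken orthogonal to `e 0` as well, to keep
    -- the pair imaginary when z is.
    obtain ⟨q, hq, hq1, hw⟩ := exists_unit_orthogonal (n := 2) (by norm_num) ![e 0, x] (by
      intro i
      fin_cases i
      · exact star_e 0
      · exact hx)
    have w0 : e 0 ⬝ᵥ q = 0 := hw 0
    have w1 : x ⬝ᵥ q = 0 := hw 1
    rw [e_dotProduct] at w0
    refine ⟨Real.arsinh √0, _, q, hsp, hq, hspp, hq1, by rw [smul_dotProduct, w1, smul_zero],
      fun h => ⟨by simp [hx0 h], w0⟩, ?_⟩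
    rw [hc, hs, hzxy, hyz, smul_inv_smul₀ hNne]
    simp
  · have hMpos' : 0 < √M := Real.sqrt_pos.mpr hMpos
    have hMne : ((√M : ℝ) : ℂ) ≠ 0 := by exact_mod_cast hMpos'.ne'
    have hsqM : ((√M : ℝ) : ℂ) * ((√M : ℝ) : ℂ) = (M : ℂ) := by
      rw [← ofReal_mul, Real.mul_self_sqrt hM0]
    refine ⟨Real.arsinh √M, _, ((√M : ℝ) : ℂ)⁻¹ • y, hsp, ?_, hspp, ?_, ?_,
      fun h => ⟨by simp [hx0 h], by simp [hy0 h]⟩, ?_⟩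
    · rw [star_smul, hy, ← starRingEnd_apply, map_inv₀, conj_ofReal]
    · rw [smul_dotProduct, dotProduct_smul, hM, ← hsqM, smul_eq_mul, smul_eq_mul]
      field_simp
    · rw [smul_dotProduct, dotProduct_smul, hP]
      simp
    · rw [hc, hs, smul_inv_smul₀ hNne, mul_smul, smul_inv_smul₀ hMne, ← hzxy]

/-! ### Exponentials -/

section Exponential

open scoped Matrix.Norms.Operator

/-- `M ↦ M x` as a continuous real linear map. -/
noncomputable def mulVecCLM (x : Oct) : Mat8 →L[ℝ] Oct :=
  LinearMap.toContinuousLinearMap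
    { toFun := fun M => M *ᵥ x
      map_add' := fun M N => add_mulVec M N x
      map_smul' := fun c M => smul_mulVec c M x }

theorem mulVecCLM_apply (x : Oct) (M : Mat8) : mulVecCLM x M = M *ᵥ x := rfl

/-- The octonion product as a continuous real bilinear map. -/
noncomputable def omulCLM : Oct →L[ℝ] Oct →L[ℝ] Oct :=
  LinearMap.toContinuousBilinearMap
    (LinearMap.mk₂ ℝ omul omul_add_left
      (fun c x y => omul_smul_left (c : ℂ) x y)
      omul_add_right
      (fun c x y => omul_smul_right (c : ℂ) x y))

theorem omulCLM_apply (x y : Oct) : omulCLM x y = omul x y := rfl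

/-- `(M, x) ↦ M x` as a continuous real bilinear map. -/
noncomputable def mulVecCLM₂ : Mat8 →L[ℝ] Oct →L[ℝ] Oct :=
  LinearMap.toContinuousBilinearMap
    (LinearMap.mk₂ ℝ (fun (M : Mat8) (v : Oct) => M *ᵥ v) (fun M N v => add_mulVec M N v)
      (fun c M v => smul_mulVec c M v) (fun M v w => mulVec_add M v w)
      (fun c M v => mulVec_smul M c v))

theorem exp_mulVec_of_eigenvector {A : Mat8} {v : Oct} {c : ℂ} (h : A *ᵥ v = c • v) :
    NormedSpace.exp A *ᵥ v = Complex.exp c • v := by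
  have hpow : ∀ n : ℕ, A ^ n *ᵥ v = c ^ n • v := by
    intro n
    induction n with
    | zero => simp
    | succ n ih => rw [pow_succ, ← mulVec_mulVec, h, mulVec_smul, ih, smul_smul, pow_succ']
  have h1 := (NormedSpace.exp_series_hasSum_exp' (𝕂 := ℝ) A).mapL (mulVecCLM v)
  have h2 := (NormedSpace.exp_series_hasSum_exp' (𝕂 := ℝ) c).smul_const v
  rw [← Complex.exp_eq_exp_ℂ] at h2
  refine h1.unique (h2.congr_fun ?_)
  intro n
  rw [map_smul, mulVecCLM_apply, hpow, smul_assoc]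

theorem hasDerivAt_exp_mulVec (X : Mat8) (x : Oct) (t : ℝ) :
    HasDerivAt (fun s : ℝ => NormedSpace.exp (s • X) *ᵥ x)
      (X *ᵥ (NormedSpace.exp (t • X) *ᵥ x)) t := by
  have h := (mulVecCLM x).hasFDerivAt.comp_hasDerivAt t
    (hasDerivAt_exp_smul_const' (𝕂 := ℝ) X t)
  rw [mulVec_mulVec]
  exact h

/-- Infinitesimal relations between the vector and the spin representation exponentiate. -/
theorem omul_exp_mulVec {X₀ X : Mat8}
    (h : ∀ x y : Oct, omul (X₀ *ᵥ x) y + omul x (X *ᵥ y) = X *ᵥ omul x y) (x y : Oct) :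
    omul (NormedSpace.exp X₀ *ᵥ x) (NormedSpace.exp X *ᵥ y) =
      NormedSpace.exp X *ᵥ omul x y := by
  -- The curve exp(−sX)((exp(sX₀)x)(exp(sX)y)) has zero derivative by the infinitesimal relation, so
  -- its values at 1 and 0 agree.
  have key : ∀ t : ℝ, HasDerivAt (fun s : ℝ => NormedSpace.exp (s • (-X)) *ᵥ
      omul (NormedSpace.exp (s • X₀) *ᵥ x) (NormedSpace.exp (s • X) *ᵥ y)) 0 t := by
    intro t
    have h1 := omulCLM.hasDerivAt_of_bilinear (fun _ => hasDerivAt_exp_mulVec X₀ x t)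
      (fun _ => hasDerivAt_exp_mulVec X y t)
    simp only [omulCLM_apply] at h1
    rw [add_comm, h] at h1
    have h2 : HasDerivAt (fun s : ℝ => NormedSpace.exp (s • (-X)))
        (NormedSpace.exp (t • (-X)) * (-X)) t := hasDerivAt_exp_smul_const (𝕂 := ℝ) (-X) t
    have h3 : HasDerivAt (fun s : ℝ => NormedSpace.exp (s • (-X)) *ᵥ
        omul (NormedSpace.exp (s • X₀) *ᵥ x) (NormedSpace.exp (s • X) *ᵥ y))
        (NormedSpace.exp (t • (-X)) *ᵥ
          (X *ᵥ omul (NormedSpace.exp (t • X₀) *ᵥ x) (NormedSpace.exp (t • X) *ᵥ y)) +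
        (NormedSpace.exp (t • (-X)) * (-X)) *ᵥ
          omul (NormedSpace.exp (t • X₀) *ᵥ x) (NormedSpace.exp (t • X) *ᵥ y)) t :=
      mulVecCLM₂.hasDerivAt_of_bilinear (fun _ => h2) (fun _ => h1)
    rw [← mulVec_mulVec, neg_mulVec, mulVec_neg, add_neg_cancel] at h3
    exact h3
  have hconst := is_const_of_deriv_eq_zero (fun t => (key t).differentiableAt)
    (fun t => (key t).deriv) 1 0
  simp only [one_smul, zero_smul, NormedSpace.exp_zero, one_mulVec] at hconst
  rw [← hconst, mulVec_mulVec, ← Matrix.exp_add_of_commute X (-X) (Commute.neg_right rfl),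
    add_neg_cancel, NormedSpace.exp_zero, one_mulVec]

/-- Infinitesimal version of multiplicativity along a one-parameter group. -/
theorem omul_of_exp {X : Mat8}
    (h : ∀ (t : ℝ) (x y : Oct), omul (NormedSpace.exp (t • X) *ᵥ x) (NormedSpace.exp (t • X) *ᵥ y) =
      NormedSpace.exp (t • X) *ᵥ omul x y) (x y : Oct) :
    omul (X *ᵥ x) y + omul x (X *ᵥ y) = X *ᵥ omul x y := by
  have h1 := omulCLM.hasDerivAt_of_bilinear (fun _ => hasDerivAt_exp_mulVec X x 0)
    (fun _ => hasDerivAt_exp_mulVec X y 0)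
  have h2 := hasDerivAt_exp_mulVec X (omul x y) 0
  simp only [omulCLM_apply, h, zero_smul, NormedSpace.exp_zero, one_mulVec] at h1 h2
  rw [add_comm]
  exact h1.unique h2

theorem hasDerivAt_exp_smul_zero (X : Mat8) :
    HasDerivAt (fun t : ℝ => NormedSpace.exp (t • X)) X 0 := by
  have h := hasDerivAt_exp_smul_const (𝕂 := ℝ) X 0
  rw [zero_smul, NormedSpace.exp_zero, one_mul] at h
  exact h

theorem commute_of_exp {X M : Mat8}
    (h : ∀ t : ℝ, NormedSpace.exp (t • X) * M = M * NormedSpace.exp (t • X)) :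
    X * M = M * X := by
  have h0 := hasDerivAt_exp_smul_zero X
  have h1 := h0.mul_const M
  have h2 := h0.const_mul M
  simp only [h] at h1
  exact h1.unique h2

theorem transpose_of_exp {X : Mat8}
    (h : ∀ t : ℝ, (NormedSpace.exp (t • X))ᵀ * NormedSpace.exp (t • X) = 1) : Xᵀ = -X := by
  have h1 := (hasDerivAt_exp_smul_zero Xᵀ).mul (hasDerivAt_exp_smul_zero X)
  have h2 : (fun t : ℝ => NormedSpace.exp (t • Xᵀ) * NormedSpace.exp (t • X)) = fun _ => 1 := by
    funext t
    rw [← h t, ← Matrix.exp_transpose, transpose_smul]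
  have h3 := h1.unique (h2 ▸ hasDerivAt_const (0 : ℝ) (1 : Mat8))
  simp only [zero_smul, NormedSpace.exp_zero, mul_one, one_mul] at h3
  exact eq_neg_of_add_eq_zero_left h3

end Exponential

/-! ### Exponentials of skew-symmetric matrices -/

theorem exp_orthogonal {A : Mat8} (hA : Aᵀ = -A) :
    (NormedSpace.exp A)ᵀ * NormedSpace.exp A = 1 := by
  rw [← Matrix.exp_transpose, hA,
    ← Matrix.exp_add_of_commute (-A) A (Commute.neg_left rfl), neg_add_cancel,
    NormedSpace.exp_zero]

theorem sq_det_of_orthogonal {M : Mat8} (h : Mᵀ * M = 1) : M.det * M.det = 1 := by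
  have := congrArg det h
  rwa [det_mul, det_transpose, det_one] at this

/-- exp A is the square of the orthogonal matrix exp(A/2), whose determinant is ±1. -/
theorem det_exp_of_skew {A : Mat8} (hA : Aᵀ = -A) : (NormedSpace.exp A).det = 1 := by
  have h : NormedSpace.exp A =
      NormedSpace.exp ((2⁻¹ : ℂ) • A) * NormedSpace.exp ((2⁻¹ : ℂ) • A) := by
    rw [← Matrix.exp_add_of_commute _ _ rfl]
    congr 1
    module
  rw [h, det_mul, sq_det_of_orthogonal (exp_orthogonal (by rw [transpose_smul, hA, smul_neg]))]

/-- The exponential of a skew-symmetric matrix, as an element of `SL(8, ℂ)`. -/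
noncomputable def expSkew (A : Mat8) (hA : Aᵀ = -A) : SL8 :=
  ⟨NormedSpace.exp A, det_exp_of_skew hA⟩

theorem coe_expSkew (A : Mat8) (hA : Aᵀ = -A) : (expSkew A hA : Mat8) = NormedSpace.exp A := rfl

theorem expSkew_mem_SO8 (A : Mat8) (hA : Aᵀ = -A) : expSkew A hA ∈ SO8 := exp_orthogonal hA

theorem exp_mulVec_of_mulVec_eq_zero {A : Mat8} {v : Oct} (h : A *ᵥ v = 0) :
    NormedSpace.exp A *ᵥ v = v := by
  rw [exp_mulVec_of_eigenvector (c := 0) (by rw [h, zero_smul]), Complex.exp_zero, one_smul]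

theorem expSkew_mem_SO7 (A : Mat8) (hA : Aᵀ = -A) (h0 : A *ᵥ e 0 = 0) : expSkew A hA ∈ SO7 :=
  ⟨expSkew_mem_SO8 A hA, exp_mulVec_of_mulVec_eq_zero h0⟩

/-- The exponential of a hyperbolic rotation generator. -/
theorem exp_smul_mulVec {A : Mat8} {u v : Oct} {c d : ℂ} (hu : A *ᵥ u = c • v)
    (hv : A *ᵥ v = d • u) (hcd : c * d = 1) (s : ℂ) :
    NormedSpace.exp (s • A) *ᵥ u = Complex.cosh s • u + (c * Complex.sinh s) • v := by
  -- u ± c v are eigenvectors of sA with eigenvalues ±s; half their sum is u.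
  have h1 : (s • A) *ᵥ (u + c • v) = s • (u + c • v) := by
    rw [smul_mulVec, mulVec_add, mulVec_smul, hu, hv, smul_smul, hcd, one_smul, add_comm]
  have h2 : (s • A) *ᵥ (u - c • v) = (-s) • (u - c • v) := by
    rw [smul_mulVec, mulVec_sub, mulVec_smul, hu, hv, smul_smul, hcd, one_smul]
    module
  have h3 : u = (2⁻¹ : ℂ) • ((u + c • v) + (u - c • v)) := by module
  conv_lhs => rw [h3]
  rw [mulVec_smul, mulVec_add, exp_mulVec_of_eigenvector h1, exp_mulVec_of_eigenvector h2,
    Complex.cosh, Complex.sinh]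
  module

/-! ### The three one-parameter groups -/

theorem alphaSO7_mulVec (t : ℂ) (x : Oct) : alphaSO7 t *ᵥ x =
    ![0, 0, -(I * t * x 3), I * t * x 2, -(I * t * x 5), I * t * x 4, -(I * t * x 7),
      I * t * x 6] := by
  ext k
  fin_cases k <;> simp [alphaSO7, mulVec, dotProduct, Fin.sum_univ_eight]

theorem alphaSpin7_mulVec (t : ℂ) (x : Oct) : alphaSpin7 t *ᵥ x =
    ![-(I * t * x 1), I * t * x 0, I * t / 3 * x 3, -(I * t / 3 * x 2), I * t / 3 * x 5,
      -(I * t / 3 * x 4), I * t / 3 * x 7, -(I * t / 3 * x 6)] := by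
  ext k
  fin_cases k <;> simp [alphaSpin7, mulVec, dotProduct, Fin.sum_univ_eight] <;> ring

theorem tauG2_mulVec (t : ℂ) (x : Oct) : tauG2 t *ᵥ x =
    ![0, -(I * t * x 2), I * t * x 1, 0, I * t / 2 * x 7, I * t / 2 * x 6, -(I * t / 2 * x 5),
      -(I * t / 2 * x 4)] := by
  ext k
  fin_cases k <;> simp [tauG2, mulVec, dotProduct, Fin.sum_univ_eight] <;> ring

theorem transpose_eq_neg_of_dotProduct {A : Mat8}
    (h : ∀ x y : Oct, (A *ᵥ x) ⬝ᵥ y + x ⬝ᵥ (A *ᵥ y) = 0) : Aᵀ = -A := by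
  ext i j
  have := h (e i) (e j)
  rw [dotProduct_e, e_dotProduct] at this
  simp only [e, mulVec_single_one] at this
  exact eq_neg_of_add_eq_zero_left this

theorem alphaSO7_transpose (t : ℂ) : (alphaSO7 t)ᵀ = -alphaSO7 t :=
  transpose_eq_neg_of_dotProduct fun x y => by
    simp only [alphaSO7_mulVec, dotProduct, Fin.sum_univ_eight, Matrix.cons_val]
    ring

theorem alphaSpin7_transpose (t : ℂ) : (alphaSpin7 t)ᵀ = -alphaSpin7 t :=
  transpose_eq_neg_of_dotProduct fun x y => by
    simp only [alphaSpin7_mulVec, dotProduct, Fin.sum_univ_eight, Matrix.cons_val]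
    ring

theorem tauG2_transpose (t : ℂ) : (tauG2 t)ᵀ = -tauG2 t :=
  transpose_eq_neg_of_dotProduct fun x y => by
    simp only [tauG2_mulVec, dotProduct, Fin.sum_univ_eight, Matrix.cons_val]
    ring

/-- This fixes the differential of the vector representation on the Cartan line. The parameter is
found by taking y = e₀: X₀x = Xx − x(Xe₀), which on e₂ equals (−it/3 + it) e₃ = (2it/3) e₃. -/
theorem omul_alphaSpin7 (t : ℂ) (x y : Oct) :
    omul (alphaSO7 (2 * t / 3) *ᵥ x) y + omul x (alphaSpin7 t *ᵥ y) = alphaSpin7 t *ᵥ omul x y := by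
  ext k
  rw [alphaSO7_mulVec, alphaSpin7_mulVec, alphaSpin7_mulVec]
  fin_cases k <;> simp [omul] <;> ring

theorem omul_tauG2 (t : ℂ) (x y : Oct) :
    omul (tauG2 t *ᵥ x) y + omul x (tauG2 t *ᵥ y) = tauG2 t *ᵥ omul x y := by
  ext k
  rw [tauG2_mulVec, tauG2_mulVec, tauG2_mulVec]
  fin_cases k <;> simp [omul] <;> ring

noncomputable def expSO7 (t : ℂ) : SL8 := expSkew (alphaSO7 t) (alphaSO7_transpose t)

noncomputable def expSpin7 (t : ℂ) : SL8 := expSkew (alphaSpin7 t) (alphaSpin7_transpose t)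

noncomputable def expG2 (t : ℂ) : SL8 := expSkew (tauG2 t) (tauG2_transpose t)

theorem expSO7_mem (t : ℂ) : expSO7 t ∈ SO7 :=
  expSkew_mem_SO7 _ _ (by
    rw [alphaSO7_mulVec]; ext k; fin_cases k <;> simp [e])

theorem related_expSpin7 (t : ℂ) : Related (expSO7 (2 * t / 3)) (expSpin7 t) :=
  omul_exp_mulVec (omul_alphaSpin7 t)

theorem expSpin7_mem (t : ℂ) : expSpin7 t ∈ Spin7 :=
  ⟨expSkew_mem_SO8 _ _, _, expSO7_mem _, related_expSpin7 t⟩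

theorem expG2_mem (t : ℂ) : expG2 t ∈ G2 :=
  ⟨expSkew_mem_SO8 _ _, omul_exp_mulVec (omul_tauG2 t)⟩

theorem expSpin7_mulVec_e_zero (t : ℂ) :
    (expSpin7 t : Mat8) *ᵥ e 0 = Complex.cosh t • e 0 + (I * Complex.sinh t) • e 1 := by
  rw [expSpin7, coe_expSkew, alphaSpin7_eq_smul]
  refine exp_smul_mulVec (d := -I) ?_ ?_ (by simp) t <;> rw [alphaSpin7_mulVec] <;> ext k <;>
    fin_cases k <;> simp [e]

theorem expG2_mulVec_e_one (t : ℂ) :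
    (expG2 t : Mat8) *ᵥ e 1 = Complex.cosh t • e 1 + (I * Complex.sinh t) • e 2 := by
  rw [expG2, coe_expSkew, tauG2_eq_smul]
  refine exp_smul_mulVec (d := -I) ?_ ?_ (by simp) t <;> rw [tauG2_mulVec] <;> ext k <;>
    fin_cases k <;> simp [e]

/-! ### The vector representation of `Spin(7, ℂ)` is onto `SO(7, ℂ)` -/

theorem mulVec_e_apply (M : Mat8) (i j : Fin 8) : (M *ᵥ e j) i = M i j := by
  simp [e]

/-- One elimination step in the manner of Cartan–Dieudonné, with two half-turns in place of
reflections so that the element lifts to `Spin7`. Each half-turn negates an imaginary basis vector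
orthogonal to its axis, so their product fixes it. -/
theorem exists_twist_twist {k : Fin 8} (hk0 : k ≠ 0) (hk7 : k ≠ 7) (z : Oct) (hz0 : z 0 = 0)
    (hz1 : z ⬝ᵥ z = 1) :
    ∃ q ∈ SO7, ∃ h ∈ Spin7, Related q h ∧ (q : Mat8) *ᵥ z = e k ∧
      ∀ j : Fin 8, j ≠ k → j ≠ 7 → z j = 0 → (q : Mat8) *ᵥ e j = e j := by
  have hek : e k 0 = 0 := by simp [e, hk0.symm]
  have hekk : e k ⬝ᵥ e k = 1 := by rw [e_dotProduct]; simp [e]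
  suffices H : ∃ a b : Oct, a 0 = 0 ∧ b 0 = 0 ∧ a ⬝ᵥ a = 1 ∧ b ⬝ᵥ b = 1 ∧
      twist b *ᵥ (twist a *ᵥ z) = e k ∧
      ∀ j : Fin 8, j ≠ k → j ≠ 7 → z j = 0 → a j = 0 ∧ b j = 0 by
    obtain ⟨a, b, ha, hb, ha1, hb1, hab, hj⟩ := H
    obtain ⟨g, hg, g₀, hg₀, -, h₀, hr⟩ := exists_leftMul_related a ha ha1
    obtain ⟨k, hk, k₀, hk₀, -, h₀', hr'⟩ := exists_leftMul_related b hb hb1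
    refine ⟨k₀ * g₀, mul_mem hk₀ hg₀, k * g, mul_mem hk hg, hr'.mul hr, ?_, ?_⟩
    · rw [Matrix.SpecialLinearGroup.coe_mul, ← mulVec_mulVec, h₀, h₀', hab]
    · intro j h1 h2 h3
      by_cases hj0 : j = 0
      · rw [hj0, (mul_mem hk₀ hg₀).2]
      obtain ⟨h4, h5⟩ := hj j h1 h2 h3
      have hej : e j 0 = 0 := by simp [e, Ne.symm hj0]
      have hm : ∀ c : Oct, c 0 = 0 → c ⬝ᵥ c = 1 → c j = 0 → twist c *ᵥ e j = -e j := by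
        intro c hc hc1 hcj
        rw [twist_mulVec c _ hc hc1, dotProduct_e, hcj, hej]
        module
      rw [Matrix.SpecialLinearGroup.coe_mul, ← mulVec_mulVec, h₀, h₀', hm a ha ha1 h4, mulVec_neg,
        hm b hb hb1 h5, neg_neg]
  -- The half-turn about the normalized z + e_k takes z to e_k, but z + e_k has square length 2 +
  -- 2z_k and is isotropic when z_k = −1. In that case the axis (z − e_k)/2 takes z to −e_k, and a
  -- half-turn about e₇ corrects the sign; hence k ≠ 7.
  by_cases hzk : z k = -1
  · have h7 : e 7 0 = 0 := by simp [e]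
    have h77 : e 7 ⬝ᵥ e 7 = 1 := by rw [e_dotProduct]; simp [e]
    have h7k : e 7 ⬝ᵥ e k = 0 := by rw [e_dotProduct]; simp [e, Ne.symm hk7]
    have ha0 : ((2⁻¹ : ℂ) • (z - e k)) 0 = 0 := by simp [hz0, hek]
    have ha1 : ((2⁻¹ : ℂ) • (z - e k)) ⬝ᵥ ((2⁻¹ : ℂ) • (z - e k)) = 1 := by
      simp only [smul_dotProduct, dotProduct_smul, sub_dotProduct, dotProduct_sub, hz1, hekk,
        e_dotProduct k z, dotProduct_e k z, hzk, smul_eq_mul]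
      norm_num
    refine ⟨(2⁻¹ : ℂ) • (z - e k), e 7, ha0, h7, ha1, h77, ?_, ?_⟩
    · have : twist ((2⁻¹ : ℂ) • (z - e k)) *ᵥ z = -e k := by
        rw [twist_mulVec _ _ ha0 ha1, hz0]
        simp only [smul_dotProduct, sub_dotProduct, hz1, e_dotProduct k z, hzk, smul_eq_mul]
        norm_num
        module
      rw [this, mulVec_neg, twist_mulVec _ _ h7 h77, hek, h7k]
      module
    · intro j h1 h2 h3
      simp [h3, e, h1, h2]
  · have hne : 2 + 2 * z k ≠ 0 := fun h => hzk (by linear_combination h / 2)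
    obtain ⟨r, hr⟩ := IsAlgClosed.exists_pow_nat_eq (2 + 2 * z k)⁻¹ (n := 2) (by norm_num)
    have hr2 : r ^ 2 * (2 + 2 * z k) = 1 := by rw [hr, inv_mul_cancel₀ hne]
    have ha0 : (r • (z + e k)) 0 = 0 := by simp [hz0, hek]
    have ha1 : (r • (z + e k)) ⬝ᵥ (r • (z + e k)) = 1 := by
      simp only [smul_dotProduct, dotProduct_smul, add_dotProduct, dotProduct_add, hz1, hekk,
        e_dotProduct k z, dotProduct_e k z, smul_eq_mul]
      linear_combination hr2
    refine ⟨r • (z + e k), e k, ha0, hek, ha1, hekk, ?_, ?_⟩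
    · have : twist (r • (z + e k)) *ᵥ z = e k := by
        rw [twist_mulVec _ _ ha0 ha1, hz0]
        simp only [smul_dotProduct, add_dotProduct, hz1, e_dotProduct k z, smul_eq_mul, smul_smul]
        have : 2 * (r * (1 + z k)) * r = 1 := by linear_combination hr2
        rw [this]
        module
      rw [this, twist_mulVec _ _ hek hekk, hek, hekk]
      module
    · intro j h1 h2 h3
      simp [h3, e, h1]

/-- Once e₀, …, e_n are fixed, the image of e_{n+1} is orthogonal to them, so the next elimination
step leaves them alone. The bound 6 keeps e₇ available as auxiliary axis. -/
theorem exists_related_fix (n : ℕ) (hn : n ≤ 6) {g : SL8} (hg : g ∈ SO7) :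
    ∃ p ∈ SO7, ∃ h ∈ Spin7, Related p h ∧
      ∀ j : Fin 8, (j : ℕ) ≤ n → ((p * g : SL8) : Mat8) *ᵥ e j = e j := by
  induction n with
  | zero =>
    refine ⟨1, one_mem _, 1, one_mem _, fun x y => by simp, fun j hj => ?_⟩
    have : j = 0 := Fin.ext (by simpa using hj)
    rw [this, one_mul, hg.2]
  | succ n ih =>
    obtain ⟨p, hp, h, hh, hr, hfix⟩ := ih (by omega)
    have hpg := mul_mem hp hg
    let k : Fin 8 := ⟨n + 1, by omega⟩
    have hk0 : k ≠ 0 := by intro h; simpa [k] using congrArg Fin.val h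
    have hk7 : k ≠ 7 := by
      intro h
      have : n + 1 = 7 := congrArg Fin.val h
      omega
    have hzj : ∀ j : Fin 8, (j : ℕ) ≤ n → (((p * g : SL8) : Mat8) *ᵥ e k) j = 0 := by
      intro j hj
      rw [← e_dotProduct j (((p * g : SL8) : Mat8) *ᵥ e k), ← hfix j hj,
        dotProduct_mulVec_of_mem_SO8 hpg.1, e_dotProduct]
      have : j ≠ k := by
        rintro rfl
        simp [k] at hj
      simp [e, this]
    obtain ⟨q, hq, h', hh', hr', hqk, hqj⟩ := exists_twist_twist hk0 hk7
      (((p * g : SL8) : Mat8) *ᵥ e k) (hzj 0 (by simp))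
      (by rw [dotProduct_mulVec_of_mem_SO8 hpg.1, e_dotProduct]; simp [e])
    refine ⟨q * p, mul_mem hq hp, h' * h, mul_mem hh' hh, hr'.mul hr, fun j hj => ?_⟩
    rw [mul_assoc, Matrix.SpecialLinearGroup.coe_mul, ← mulVec_mulVec]
    rcases Nat.le_succ_iff.mp hj with hj' | hj'
    · rw [hfix j hj', hqj j ?_ ?_ (hzj j hj')]
      · rintro rfl
        simp [k] at hj'
      · rintro rfl
        have : (7 : ℕ) ≤ n := hj'
        omega
    · have : j = k := Fin.ext hj'
      rw [this, hqk]

/-- After e₀, …, e₆ have been fixed, orthogonality leaves a diagonal matrix with one unknown entry,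
and determinant one makes it 1. So g is the inverse of an element that lifts. -/
theorem exists_related_of_mem_SO7 {g : SL8} (hg : g ∈ SO7) : ∃ h ∈ Spin7, Related g h := by
  obtain ⟨p, hp, h, hh, hr, hfix⟩ := exists_related_fix 6 le_rfl hg
  suffices H : p * g = 1 by
    rw [eq_inv_of_mul_eq_one_right H]
    exact ⟨h⁻¹, inv_mem hh, hr.inv⟩
  have hpg := mul_mem hp hg
  set M : Mat8 := ((p * g : SL8) : Mat8) with hM
  have hdiag : M = diagonal fun j => if j = 7 then M 7 7 else 1 := by
    ext i j
    rw [← mulVec_e_apply M]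
    by_cases hj : j = 7
    · subst hj
      by_cases hi : i = 7
      · subst hi
        simp [mulVec_e_apply]
      · have hi' : (i : ℕ) ≤ 6 := by
          have : (i : ℕ) ≠ 7 := fun h => hi (Fin.ext h)
          omega
        rw [← e_dotProduct i (M *ᵥ e 7), ← hfix i hi', dotProduct_mulVec_of_mem_SO8 hpg.1,
          e_dotProduct, diagonal_apply_ne _ hi]
        simp [e, hi]
    · have hj' : (j : ℕ) ≤ 6 := by
        have : (j : ℕ) ≠ 7 := fun h => hj (Fin.ext h)
        omega
      rw [hfix j hj']
      by_cases hij : i = j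
      · subst hij
        simp [e, hj]
      · simp [e, hij]
  have hdet : M.det = 1 := (p * g).2
  rw [hdiag, det_diagonal, Fin.prod_univ_eight] at hdet
  have h77 : M 7 7 = 1 := by simpa [Fin.ext_iff] using hdet
  apply Subtype.ext
  change M = 1
  rw [hdiag, h77]
  simp

/-! ### The decompositions -/

/-- With g e₀ = cosh s p + i sinh s q and k carrying (e₀, e₁) to (p, q), the element k exp(sA) has
the same value at e₀ as g; the quotient lies in the stabilizer `G2`. -/
theorem exists_decomposition_Spin7 {g : SL8} (hg : g ∈ Spin7) :
    ∃ k ∈ Spin7, conjSL k = k ∧ ∃ t : ℝ, ∃ h ∈ G2, g = k * expSpin7 t * h := by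
  obtain ⟨s, p, q, hp, hq, hp1, hq1, hpq, -, hz⟩ := exists_cosh_sinh ((g : Mat8) *ᵥ e 0)
    (by rw [dotProduct_mulVec_of_mem_SO8 hg.1, e_dotProduct]; simp [e])
  obtain ⟨k, hk, hkc, hkp, hkq⟩ := exists_Spin7_pair hp hq hp1 hq1 hpq
  have hm := mul_mem hk (expSpin7_mem s)
  have hmem : (k * expSpin7 s)⁻¹ * g ∈ Spin7 := mul_mem (inv_mem hm) hg
  refine ⟨k, hk, hkc, s, (k * expSpin7 s)⁻¹ * g, ?_, by group⟩
  have hfix : (((k * expSpin7 s)⁻¹ * g : SL8) : Mat8) *ᵥ e 0 = e 0 := by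
    have h1 : ((k * expSpin7 s : SL8) : Mat8) *ᵥ e 0 = (g : Mat8) *ᵥ e 0 := by
      rw [Matrix.SpecialLinearGroup.coe_mul, ← mulVec_mulVec, expSpin7_mulVec_e_zero, mulVec_add,
        mulVec_smul, mulVec_smul, hkp, hkq, hz]
    rw [Matrix.SpecialLinearGroup.coe_mul, ← mulVec_mulVec, ← h1, inv_mulVec_mulVec]
  obtain ⟨hs, g₀, -, hr⟩ := hmem
  exact mem_G2_of_related hs hr hfix

/-- Lift g to `Spin7`, decompose there and project factor by factor. The projection k₀ is real
because its conjugate is related to the same k, and `Related.unique` applies. -/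
theorem exists_decomposition_SO7 {g : SL8} (hg : g ∈ SO7) :
    ∃ k ∈ SO7, conjSL k = k ∧ ∃ t : ℝ, ∃ h ∈ G2, g = k * expSO7 t * h := by
  obtain ⟨g', hg', hr⟩ := exists_related_of_mem_SO7 hg
  obtain ⟨k, hk, hkc, t, h, hh, rfl⟩ := exists_decomposition_Spin7 hg'
  obtain ⟨-, k₀, hk₀, hrk⟩ := hk
  refine ⟨k₀, hk₀, ?_, 2 * t / 3, h, hh, ?_⟩
  · have h := Related.conjSL hrk
    rw [hkc] at h
    exact Related.unique h hrk
  · have h := (Related.mul hrk (related_expSpin7 t)).mul hh.2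
    rw [hr.unique h]
    push_cast
    rfl

/-- The sphere argument again, now among imaginary octonions with base pair (e₁, e₂). -/
theorem exists_decomposition_G2 {g : SL8} (hg : g ∈ G2) :
    ∃ k ∈ G2, conjSL k = k ∧ ∃ t : ℝ, ∃ h ∈ SL3, g = k * expG2 t * h := by
  have hz0 : ((g : Mat8) *ᵥ e 1) 0 = 0 := by
    rw [← e_dotProduct 0 ((g : Mat8) *ᵥ e 1), ← mulVec_e_zero_of_mem_G2 hg,
      dotProduct_mulVec_of_mem_SO8 hg.1, e_dotProduct]
    simp [e]
  obtain ⟨s, p, q, hp, hq, hp1, hq1, hpq, h0, hz⟩ := exists_cosh_sinh ((g : Mat8) *ᵥ e 1)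
    (by rw [dotProduct_mulVec_of_mem_SO8 hg.1, e_dotProduct]; simp [e])
  obtain ⟨hp0, hq0⟩ := h0 hz0
  obtain ⟨k, hk, hkc, hkp, hkq⟩ := exists_G2_pair (star_e 1) (star_e 2) hp hq (by simp [e])
    (by simp [e]) hp0 hq0 (by simp [e]) (by simp [e]) hp1 hq1 (by simp [e]) hpq
  have hm := mul_mem hk (expG2_mem s)
  refine ⟨k, hk, hkc, s, (k * expG2 s)⁻¹ * g, ⟨mul_mem (inv_mem hm) hg, ?_⟩, by group⟩
  have h1 : ((k * expG2 s : SL8) : Mat8) *ᵥ e 1 = (g : Mat8) *ᵥ e 1 := by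
    rw [Matrix.SpecialLinearGroup.coe_mul, ← mulVec_mulVec, expG2_mulVec_e_one, mulVec_add,
      mulVec_smul, mulVec_smul, hkp, hkq, hz]
  rw [Matrix.SpecialLinearGroup.coe_mul, ← mulVec_mulVec, ← h1, inv_mulVec_mulVec]

/-! ### One-parameter elements normalizing the small group -/

theorem mulVec_of_conj_mulVec {m x : SL8} {v : Oct}
    (h : ((m⁻¹ * x * m : SL8) : Mat8) *ᵥ v = v) :
    (x : Mat8) *ᵥ ((m : Mat8) *ᵥ v) = (m : Mat8) *ᵥ v := by
  have := congrArg (fun w => (m : Mat8) *ᵥ w) h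
  simp only [mul_assoc, Matrix.SpecialLinearGroup.coe_mul, ← mulVec_mulVec,
    mulVec_inv_mulVec] at this
  exact this

theorem eq_zero_of_sinh {t : ℝ} (h : Complex.sinh t = 0) : t = 0 := by
  rw [← ofReal_sinh, ofReal_eq_zero, Real.sinh_eq_zero] at h
  exact h

/-- The hypothesis makes all of `G2` fix cosh t e₀ + i sinh t e₁. An automorphism sending e₁ to −e₁
then gives sinh t = 0. -/
theorem eq_zero_of_normalize_Spin7 {t : ℝ}
    (h : ∀ x ∈ G2, (expSpin7 t)⁻¹ * x * expSpin7 t ∈ G2) : t = 0 := by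
  obtain ⟨x, hx, -, hx1⟩ := exists_G2_sphere (p := e 1) (q := -e 1) (star_e 1)
    (by rw [star_neg, star_e]) (by simp [e]) (by simp [e]) (by simp [e]) (by simp [e])
  have h1 := mulVec_of_conj_mulVec (mulVec_e_zero_of_mem_G2 (h x hx))
  rw [expSpin7_mulVec_e_zero, mulVec_add, mulVec_smul, mulVec_smul, hx1,
    mulVec_e_zero_of_mem_G2 hx] at h1
  have h2 := congrFun h1 1
  simp [e] at h2
  apply eq_zero_of_sinh
  have h3 : I * Complex.sinh t = 0 := by linear_combination -h2 / 2
  simpa using h3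

/-- Similarly, all of `SL3` fixes cosh t e₁ + i sinh t e₂, and some element of it sends e₂ to −e₂.
-/
theorem eq_zero_of_normalize_G2 {t : ℝ}
    (h : ∀ x ∈ SL3, (expG2 t)⁻¹ * x * expG2 t ∈ SL3) : t = 0 := by
  obtain ⟨x, hx, -, hx1, hx2⟩ := exists_G2_pair (p := e 1) (q := e 2) (p' := e 1) (q' := -e 2)
    (star_e 1) (star_e 2) (star_e 1)
    (by rw [star_neg, star_e]) (by simp [e]) (by simp [e]) (by simp [e]) (by simp [e])
    (by simp [e]) (by simp [e]) (by simp [e]) (by simp [e]) (by simp [e]) (by simp [e])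
  have h1 := mulVec_of_conj_mulVec (h x ⟨hx, hx1⟩).2
  rw [expG2_mulVec_e_one, mulVec_add, mulVec_smul, mulVec_smul, hx1, hx2] at h1
  have h2 := congrFun h1 2
  simp [e] at h2
  apply eq_zero_of_sinh
  have h3 : I * Complex.sinh t = 0 := by linear_combination -h2 / 2
  simpa using h3

theorem expSO7_mulVec_e_one (t : ℂ) : (expSO7 t : Mat8) *ᵥ e 1 = e 1 :=
  exp_mulVec_of_mulVec_eq_zero (by rw [alphaSO7_mulVec]; ext k; fin_cases k <;> simp [e])

theorem expSO7_mulVec_e_two (t : ℂ) :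
    (expSO7 t : Mat8) *ᵥ e 2 = Complex.cosh t • e 2 + (I * Complex.sinh t) • e 3 := by
  rw [expSO7, coe_expSkew, alphaSO7_eq_smul]
  refine exp_smul_mulVec (d := -I) ?_ ?_ (by simp) t <;> rw [alphaSO7_mulVec] <;> ext k <;>
    fin_cases k <;> simp [e]

theorem expSO7_mulVec_e_four (t : ℂ) :
    (expSO7 t : Mat8) *ᵥ e 4 = Complex.cosh t • e 4 + (I * Complex.sinh t) • e 5 := by
  rw [expSO7, coe_expSkew, alphaSO7_eq_smul]
  refine exp_smul_mulVec (d := -I) ?_ ?_ (by simp) t <;> rw [alphaSO7_mulVec] <;> ext k <;>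
    fin_cases k <;> simp [e]

theorem expSO7_mulVec_e_six (t : ℂ) :
    (expSO7 t : Mat8) *ᵥ e 6 = Complex.cosh t • e 6 + (I * Complex.sinh t) • e 7 := by
  rw [expSO7, coe_expSkew, alphaSO7_eq_smul]
  refine exp_smul_mulVec (d := -I) ?_ ?_ (by simp) t <;> rw [alphaSO7_mulVec] <;> ext k <;>
    fin_cases k <;> simp [e]

theorem expSkew_neg_mul {A : Mat8} (hA : Aᵀ = -A) (hA' : (-A)ᵀ = -(-A)) :
    expSkew (-A) hA' * expSkew A hA = 1 := by
  apply Subtype.ext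
  change NormedSpace.exp (-A) * NormedSpace.exp A = 1
  rw [← Matrix.exp_add_of_commute (-A) A (Commute.neg_left rfl), neg_add_cancel,
    NormedSpace.exp_zero]

theorem expSO7_inv (t : ℂ) : (expSO7 t)⁻¹ = expSO7 (-t) := by
  symm
  apply eq_inv_of_mul_eq_one_left
  have h : alphaSO7 (-t) = -alphaSO7 t := by
    rw [alphaSO7_eq_smul, alphaSO7_eq_smul t, neg_smul]
  simp only [expSO7, h]
  exact expSkew_neg_mul _ _

theorem expSO7_commute_leftMul (t : ℂ) (x : Oct) :
    (expSO7 t : Mat8) *ᵥ omul (e 1) x = omul (e 1) ((expSO7 t : Mat8) *ᵥ x) := by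
  have h : Commute (alphaSO7 t) (leftMul (e 1)) := by
    apply ext_mulVec
    intro x
    rw [← mulVec_mulVec, ← mulVec_mulVec, leftMul_mulVec, leftMul_mulVec, alphaSO7_mulVec,
      alphaSO7_mulVec]
    ext k
    fin_cases k <;> simp [omul, e]
  have h' : Commute (NormedSpace.exp (alphaSO7 t)) (leftMul (e 1)) :=
    open scoped Matrix.Norms.Operator in h.exp_left
  rw [← leftMul_mulVec, ← leftMul_mulVec, mulVec_mulVec, mulVec_mulVec]
  exact congrArg (· *ᵥ x) h'

/-- No sphere is available here. Instead `expSO7 t` fixes e₁ and commutes with left multiplication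
by e₁; conjugating by an automorphism that moves e₁ to e₂ yields a multiplicativity in e₂ which
fails unless t = 0. -/
theorem eq_zero_of_normalize_SO7 {t : ℝ}
    (h : ∀ x ∈ G2, (expSO7 t)⁻¹ * x * expSO7 t ∈ G2) : t = 0 := by
  obtain ⟨g, hg, -, hg1⟩ := exists_G2_sphere (p := e 1) (q := e 2) (star_e 1)
    (star_e 2) (by simp [e]) (by simp [e]) (by simp [e]) (by simp [e])
  have hg' := h g hg
  -- With m = `expSO7 t`, apply the automorphism m⁻¹gm to the product of e₁ and m⁻¹g⁻¹y.
  have key : ∀ y : Oct, (expSO7 (-t) : Mat8) *ᵥ omul (e 2) y =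
      omul ((expSO7 (-t) : Mat8) *ᵥ e 2) ((expSO7 (-t) : Mat8) *ᵥ y) := by
    intro y
    have hy := hg'.2 (e 1) (((expSO7 t)⁻¹ : SL8) *ᵥ (((g⁻¹ : SL8) : Mat8) *ᵥ y))
    simp only [Matrix.SpecialLinearGroup.coe_mul, ← mulVec_mulVec, expSO7_mulVec_e_one, hg1,
      expSO7_commute_leftMul, mulVec_inv_mulVec] at hy
    rw [← hg.2, hg1, mulVec_inv_mulVec, expSO7_inv] at hy
    exact hy.symm
  have h4 := key (e 4)
  have h24 : omul (e 2) (e 4) = -e 6 := by ext k; fin_cases k <;> simp [omul, e]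
  rw [h24, mulVec_neg, expSO7_mulVec_e_two, expSO7_mulVec_e_four, expSO7_mulVec_e_six] at h4
  have h7 := congrFun h4 7
  simp [omul, e] at h7
  -- At y = e₄ the e₇-coordinate of the identity reads i sinh t (2 cosh t + 1) = 0.
  have hc : 2 * Complex.cosh t + 1 ≠ 0 := by
    rw [← ofReal_cosh]
    have := Real.one_le_cosh t
    norm_cast
    linarith
  apply eq_zero_of_sinh
  have h8 : (I * Complex.sinh t) * (2 * Complex.cosh t + 1) = 0 := by
    linear_combination h7
  simpa [hc] using h8

/-! ### The adjoint action and the Killing form -/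

theorem coe_mul_coe_inv (v : SL8) : (v : Mat8) * ((v⁻¹ : SL8) : Mat8) = 1 := by
  rw [← Matrix.SpecialLinearGroup.coe_mul, mul_inv_cancel, Matrix.SpecialLinearGroup.coe_one]

theorem coe_inv_mul_coe (v : SL8) : ((v⁻¹ : SL8) : Mat8) * (v : Mat8) = 1 := by
  rw [← Matrix.SpecialLinearGroup.coe_mul, inv_mul_cancel, Matrix.SpecialLinearGroup.coe_one]

/-- Conjugation by an element of `SL(8, ℂ)`, as an automorphism of the matrix Lie algebra. -/
def conjLie (v : SL8) : Mat8 ≃ₗ⁅ℂ⁆ Mat8 where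
  toFun X := (v : Mat8) * X * ((v⁻¹ : SL8) : Mat8)
  invFun X := ((v⁻¹ : SL8) : Mat8) * X * (v : Mat8)
  map_add' X Y := by rw [Matrix.mul_add, Matrix.add_mul]
  map_smul' c X := by rw [Matrix.mul_smul, Matrix.smul_mul, RingHom.id_apply]
  map_lie' {X Y} := by
    have h : ∀ X Y : Mat8, (v : Mat8) * (X * Y) * ((v⁻¹ : SL8) : Mat8) =
        ((v : Mat8) * X * ((v⁻¹ : SL8) : Mat8)) * ((v : Mat8) * Y * ((v⁻¹ : SL8) : Mat8)) := by
      intro X Y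
      calc _ = (v : Mat8) * X * 1 * Y * ((v⁻¹ : SL8) : Mat8) := by noncomm_ring
        _ = _ := by rw [← coe_inv_mul_coe v]; noncomm_ring
    change (v : Mat8) * ⁅X, Y⁆ * _ = ⁅_, _⁆
    rw [LieRing.of_associative_ring_bracket, LieRing.of_associative_ring_bracket, ← h, ← h,
      Matrix.mul_sub, Matrix.sub_mul]
  left_inv X := by
    calc _ = (((v⁻¹ : SL8) : Mat8) * (v : Mat8)) * X * (((v⁻¹ : SL8) : Mat8) * (v : Mat8)) := by
          noncomm_ring
      _ = X := by rw [coe_inv_mul_coe, Matrix.one_mul, Matrix.mul_one]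
  right_inv X := by
    calc _ = ((v : Mat8) * ((v⁻¹ : SL8) : Mat8)) * X * ((v : Mat8) * ((v⁻¹ : SL8) : Mat8)) := by
          noncomm_ring
      _ = X := by rw [coe_mul_coe_inv, Matrix.one_mul, Matrix.mul_one]

theorem conjLie_apply (v : SL8) (X : Mat8) :
    conjLie v X = (v : Mat8) * X * ((v⁻¹ : SL8) : Mat8) := rfl

theorem conjLie_inv_conjLie (v : SL8) (X : Mat8) : conjLie v⁻¹ (conjLie v X) = X := by
  rw [conjLie_apply, inv_inv]
  exact (conjLie v).left_inv X

theorem conjLie_conjLie_inv (v : SL8) (X : Mat8) : conjLie v (conjLie v⁻¹ X) = X := by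
  conv_lhs => rw [conjLie_apply v⁻¹, inv_inv]
  exact (conjLie v).right_inv X

theorem exp_conjLie (v : SL8) (X : Mat8) :
    NormedSpace.exp (conjLie v X) =
      (v : Mat8) * NormedSpace.exp X * ((v⁻¹ : SL8) : Mat8) :=
  Matrix.exp_units_conj ⟨(v : Mat8), ((v⁻¹ : SL8) : Mat8), coe_mul_coe_inv v, coe_inv_mul_coe v⟩ X

theorem conjLie_mem_lieAlg {G : Subgroup SL8} {v : SL8} (hv : v ∈ G) {X : Mat8}
    (hX : X ∈ lieAlg G) : conjLie v X ∈ lieAlg G := by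
  induction hX using LieSubalgebra.lieSpan_induction with
  | mem X hX =>
    refine LieSubalgebra.subset_lieSpan fun t => ?_
    obtain ⟨g, hg, hgX⟩ := hX t
    refine ⟨v * g * v⁻¹, mul_mem (mul_mem hv hg) (inv_mem hv), ?_⟩
    rw [← map_smul, exp_conjLie, ← hgX, Matrix.SpecialLinearGroup.coe_mul,
      Matrix.SpecialLinearGroup.coe_mul]
  | zero => rw [map_zero]; exact LieSubalgebra.zero_mem _
  | add X Y _ _ h h' => rw [map_add]; exact LieSubalgebra.add_mem _ h h'
  | smul c X _ h => rw [map_smul]; exact LieSubalgebra.smul_mem _ _ h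
  | lie X Y _ _ h h' => rw [LieEquiv.map_lie]; exact LieSubalgebra.lie_mem _ h h'

/-- The adjoint action of `v ∈ G` on the Lie algebra of `G`. -/
noncomputable def adEquiv {G : Subgroup SL8} {v : SL8} (hv : v ∈ G) : lieAlg G ≃ₗ⁅ℂ⁆ lieAlg G :=
  LieEquiv.ofSubalgebras (lieAlg G) (lieAlg G) (conjLie v) (by
    apply le_antisymm
    · rintro _ ⟨X, hX, rfl⟩
      exact conjLie_mem_lieAlg hv hX
    · intro X hX
      exact ⟨conjLie v⁻¹ X, conjLie_mem_lieAlg (inv_mem hv) hX, conjLie_conjLie_inv v X⟩)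

theorem coe_adEquiv {G : Subgroup SL8} {v : SL8} (hv : v ∈ G) (X : lieAlg G) :
    ((adEquiv hv X : lieAlg G) : Mat8) = (v : Mat8) * X * ((v⁻¹ : SL8) : Mat8) := rfl

theorem killingForm_adEquiv {G : Subgroup SL8} {v : SL8} (hv : v ∈ G) (X Y : lieAlg G) :
    killingForm ℂ (lieAlg G) (adEquiv hv X) (adEquiv hv Y) = killingForm ℂ (lieAlg G) X Y :=
  LieAlgebra.killingForm_of_equiv_apply _ X Y

theorem ofReal_smul_matrix (t : ℝ) (X : Mat8) : (t : ℂ) • X = t • X := rfl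

/-- Elements of `Lie G₂` are skew-symmetric derivations. -/
theorem derivation_of_mem_lieAlg_G2 {X : Mat8} (hX : X ∈ lieAlg G2) :
    Xᵀ = -X ∧ ∀ x y : Oct, omul (X *ᵥ x) y + omul x (X *ᵥ y) = X *ᵥ omul x y := by
  induction hX using LieSubalgebra.lieSpan_induction with
  | mem X hX =>
    constructor
    · refine transpose_of_exp fun t => ?_
      obtain ⟨g, hg, hgX⟩ := hX t
      rw [← ofReal_smul_matrix, ← hgX]
      exact hg.1
    · refine omul_of_exp fun t => ?_
      obtain ⟨g, hg, hgX⟩ := hX t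
      rw [← ofReal_smul_matrix, ← hgX]
      exact hg.2
  | zero =>
    refine ⟨by simp, fun x y => ?_⟩
    have h := omul_smul_left 0 0 y
    have h' := omul_smul_right 0 x 0
    simp only [zero_smul] at h h'
    simp [h, h']
  | add X Y _ _ hX hY =>
    refine ⟨by rw [transpose_add, hX.1, hY.1, neg_add], fun x y => ?_⟩
    rw [add_mulVec, add_mulVec, add_mulVec, omul_add_left, omul_add_right, ← hX.2, ← hY.2]
    abel
  | smul c X _ hX =>
    refine ⟨by rw [transpose_smul, hX.1, smul_neg], fun x y => ?_⟩
    rw [smul_mulVec, smul_mulVec, smul_mulVec, omul_smul_left, omul_smul_right, ← hX.2, smul_add]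
  | lie X Y _ _ hX hY =>
    rw [LieRing.of_associative_ring_bracket]
    refine ⟨?_, fun x y => ?_⟩
    · rw [transpose_sub, transpose_mul, transpose_mul, hX.1, hY.1]
      noncomm_ring
    · simp only [sub_mulVec, ← mulVec_mulVec, omul_sub_left, omul_sub_right, ← hX.2, ← hY.2,
        mulVec_add]
      abel

/-! ### A finite subgroup of `G₂` without invariants in its Lie algebra -/

theorem coe_inv_of_mem_SO8 {g : SL8} (hg : g ∈ SO8) : ((g⁻¹ : SL8) : Mat8) = (g : Mat8)ᵀ :=
  (left_inv_eq_right_inv hg (coe_mul_coe_inv g)).symm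

/-- Sign changes that are automorphisms fixing `e₁`. -/
def signA : Fin 8 → ℂ := ![1, 1, 1, 1, -1, -1, -1, -1]

/-- Sign changes that are automorphisms fixing `e₁`. -/
def signB : Fin 8 → ℂ := ![1, 1, -1, -1, 1, 1, -1, -1]

theorem exists_diagonal_mem_SL3 (d : Fin 8 → ℂ) (hd : d = signA ∨ d = signB) :
    ∃ g ∈ SL3, (g : Mat8) = diagonal d := by
  have hdet : (diagonal d).det = 1 := by
    rw [det_diagonal, Fin.prod_univ_eight]
    rcases hd with rfl | rfl <;> simp [signA, signB]
  have hsq : (diagonal d)ᵀ * diagonal d = 1 := by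
    rw [diagonal_transpose, diagonal_mul_diagonal, ← diagonal_one]
    congr 1
    ext k
    rcases hd with rfl | rfl <;> fin_cases k <;> simp [signA, signB]
  refine ⟨⟨diagonal d, hdet⟩, ⟨⟨hsq, fun x y => ?_⟩, ?_⟩, rfl⟩
  · change omul (diagonal d *ᵥ x) (diagonal d *ᵥ y) = diagonal d *ᵥ omul x y
    ext k
    rcases hd with rfl | rfl <;> fin_cases k <;> simp [mulVec_diagonal, omul, signA, signB] <;> ring
  · change diagonal d *ᵥ e 1 = e 1
    ext k
    rcases hd with rfl | rfl <;> fin_cases k <;> simp [mulVec_diagonal, signA, signB, e]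

/-- The cyclic permutation of `(e₂, e₄, e₆)` and `(e₃, e₅, e₇)`. -/
def cyc : Equiv.Perm (Fin 8) where
  toFun := ![0, 1, 6, 7, 2, 3, 4, 5]
  invFun := ![0, 1, 4, 5, 6, 7, 2, 3]
  left_inv := by decide
  right_inv := by decide

theorem exists_cyc_mem_SL3 : ∃ g ∈ SL3, (g : Mat8) = cyc.permMatrix ℂ := by
  have hdet : (cyc.permMatrix ℂ).det = 1 := by
    rw [det_permutation]
    have : Equiv.Perm.sign cyc = 1 := by decide
    rw [this]
    simp
  have hT : (cyc.permMatrix ℂ)ᵀ * cyc.permMatrix ℂ = 1 := by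
    rw [transpose_permMatrix, ← permMatrix_mul, mul_inv_cancel, permMatrix_one]
  have hmul : ∀ x : Oct, cyc.permMatrix ℂ *ᵥ x = x ∘ cyc := fun x =>
    permMatrix_mulVec cyc
  refine ⟨⟨cyc.permMatrix ℂ, hdet⟩, ⟨⟨hT, fun x y => ?_⟩, ?_⟩, rfl⟩
  · change omul (cyc.permMatrix ℂ *ᵥ x) (cyc.permMatrix ℂ *ᵥ y) = cyc.permMatrix ℂ *ᵥ omul x y
    rw [hmul, hmul, hmul]
    ext k
    fin_cases k <;> simp [omul, cyc] <;> ring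
  · change cyc.permMatrix ℂ *ᵥ e 1 = e 1
    rw [hmul]
    ext k
    fin_cases k <;> simp [e, cyc]

theorem conj_permMatrix_apply (σ : Equiv.Perm (Fin 8)) (Y : Mat8) (i j : Fin 8) :
    (σ.permMatrix ℂ * Y * (σ.permMatrix ℂ)ᵀ) i j = Y (σ i) (σ j) := by
  rw [transpose_permMatrix, PEquiv.toMatrix_toPEquiv_mul, PEquiv.mul_toMatrix_toPEquiv]
  rfl

theorem conj_diagonal_apply (d : Fin 8 → ℂ) (Y : Mat8) (i j : Fin 8) :
    (diagonal d * Y * (diagonal d)ᵀ) i j = d i * Y i j * d j := by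
  rw [diagonal_transpose, mul_diagonal, diagonal_mul]

/-- The average of a skew derivation over the group generated by the sign changes and the cyclic
permutation vanishes. -/
theorem average_eq_zero {Y : Mat8} (hT : Yᵀ = -Y)
    (hD : ∀ x y : Oct, omul (Y *ᵥ x) y + omul x (Y *ᵥ y) = Y *ᵥ omul x y) {Z W : Mat8}
    (hZ : ∀ i j, Z i j = Y i j + signA i * Y i j * signA j)
    (hW : ∀ i j, W i j = Z i j + signB i * Z i j * signB j) (i j : Fin 8) :
    W i j + W (cyc i) (cyc j) + W (cyc (cyc i)) (cyc (cyc j)) = 0 := by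
  have hs : ∀ i j, Y i j = -Y j i := fun i j => congrFun (congrFun hT j) i
  have hd : ∀ i, Y i i = 0 := fun i => self_eq_neg.mp (hs i i)
  have h0 : ∀ i, Y i 0 = 0 := fun i => by
    have h := hD (e 0) (e 0)
    rw [(omul_unit _).1, (omul_unit _).2, (omul_unit _).1, add_eq_left] at h
    rw [← mulVec_e_apply Y, h, Pi.zero_apply]
  have h0' : ∀ i, Y 0 i = 0 := fun i => by rw [hs, h0, neg_zero]
  -- The e₇-coordinate of the derivation rule for e₂e₄ = −e₆. Averaging over signs leaves only
  -- entries within the blocks {0,1}, {2,3}, {4,5}, {6,7}; the first block vanishes since Y kills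
  -- e₀, and this relation makes the cyclic sum of the others zero.
  have h76 : Y 7 6 = -Y 5 4 - Y 3 2 := by
    have h := congrFun (hD (e 2) (e 4)) 7
    have h24 : omul (e 2) (e 4) = -e 6 := by ext k; fin_cases k <;> simp [omul, e]
    rw [h24, mulVec_neg, Pi.neg_apply, mulVec_e_apply] at h
    have h3 : omul (Y *ᵥ e 2) (e 4) 7 = Y 3 2 := by
      simp [omul, e]
    have h5 : omul (e 2) (Y *ᵥ e 4) 7 = Y 5 4 := by
      simp [omul, e]
    rw [Pi.add_apply, h3, h5] at h
    linear_combination h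
  have h23 := hs 2 3
  have h45 := hs 4 5
  have h67 := hs 6 7
  simp only [hW, hZ]
  fin_cases i <;> fin_cases j <;> simp [cyc, signA, signB, hd, h0, h0', h23, h45, h67, h76] <;> ring

/-- An element commuting with the sign changes and the cyclic permutation is Killing orthogonal
to `Lie G₂`. -/
theorem killingForm_eq_zero_of_commute {G : Subgroup SL8} (hG : G2 ≤ G) {A : Mat8}
    (hA : ∀ d, d = signA ∨ d = signB → ∀ i j, d i * A i j * d j = A i j)
    (hAc : ∀ i j, A (cyc i) (cyc j) = A i j) (hAG : A ∈ lieAlg G) {Y : Mat8} (hY : Y ∈ lieAlg G)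
    (hYH : Y ∈ lieAlg G2) : killingForm ℂ (lieAlg G) ⟨A, hAG⟩ ⟨Y, hY⟩ = 0 := by
  obtain ⟨a, ha, hac⟩ := exists_diagonal_mem_SL3 signA (Or.inl rfl)
  obtain ⟨b, hb, hbc⟩ := exists_diagonal_mem_SL3 signB (Or.inr rfl)
  obtain ⟨c, hc, hcc⟩ := exists_cyc_mem_SL3
  have haG : a ∈ G := hG ha.1
  have hbG : b ∈ G := hG hb.1
  have hcG : c ∈ G := hG hc.1
  have ea : ∀ X : lieAlg G, ∀ i j, ((adEquiv haG X : lieAlg G) : Mat8) i j =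
      signA i * (X : Mat8) i j * signA j := fun X i j => by
    rw [coe_adEquiv, coe_inv_of_mem_SO8 ha.1.1, hac, conj_diagonal_apply]
  have eb : ∀ X : lieAlg G, ∀ i j, ((adEquiv hbG X : lieAlg G) : Mat8) i j =
      signB i * (X : Mat8) i j * signB j := fun X i j => by
    rw [coe_adEquiv, coe_inv_of_mem_SO8 hb.1.1, hbc, conj_diagonal_apply]
  have ec : ∀ X : lieAlg G, ∀ i j, ((adEquiv hcG X : lieAlg G) : Mat8) i j =
      (X : Mat8) (cyc i) (cyc j) := fun X i j => by
    rw [coe_adEquiv, coe_inv_of_mem_SO8 hc.1.1, hcc, conj_permMatrix_apply]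
  set A' : lieAlg G := ⟨A, hAG⟩ with hA'
  set Y' : lieAlg G := ⟨Y, hY⟩ with hY'
  -- When Ad(v) fixes A, invariance of the Killing form lets v be dropped from the second argument.
  have inv : ∀ {v : SL8} (hv : v ∈ G), adEquiv hv A' = A' → ∀ X : lieAlg G,
      killingForm ℂ (lieAlg G) A' (adEquiv hv X) = killingForm ℂ (lieAlg G) A' X := by
    intro v hv h X
    conv_lhs => rw [← h]
    exact killingForm_adEquiv hv A' X
  have ia := inv haG (Subtype.ext (by ext i j; rw [ea]; exact hA _ (Or.inl rfl) i j))
  have ib := inv hbG (Subtype.ext (by ext i j; rw [eb]; exact hA _ (Or.inr rfl) i j))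
  have ic := inv hcG (Subtype.ext (by ext i j; rw [ec]; exact hAc i j))
  set Z : lieAlg G := Y' + adEquiv haG Y' with hZ
  set W : lieAlg G := Z + adEquiv hbG Z with hW
  have hsum : W + adEquiv hcG W + adEquiv hcG (adEquiv hcG W) = 0 := by
    apply Subtype.ext
    ext i j
    obtain ⟨hT, hD⟩ := derivation_of_mem_lieAlg_G2 hYH
    have := average_eq_zero hT hD (Z := Z) (W := W)
      (fun i j => by rw [← ea Y' i j]; rfl) (fun i j => by rw [← eb Z i j]; rfl) i j
    change (W : Mat8) i j + ((adEquiv hcG W : lieAlg G) : Mat8) i j +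
      ((adEquiv hcG (adEquiv hcG W) : lieAlg G) : Mat8) i j = 0
    rw [ec, ec, ec]
    exact this
  -- The vanishing sum has 2 · 2 · 3 terms, each pairing with A as Y does: 12 B(A, Y) = 0.
  have h := congrArg (killingForm ℂ (lieAlg G) A') hsum
  rw [map_add, map_add, ic, ic, ic, hW, map_add, ib, hZ, map_add, ia, map_zero] at h
  linear_combination h / 12

/-! ### The centre of `SL(3, ℂ)` -/

/-- The element acting by a primitive cube root of unity on the complement of `e₀, e₁`
(when `b² = 3 / 4`). -/
noncomputable def zetaMat (b : ℂ) : Mat8 := Matrix.of fun i j =>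
  ![(e j : Oct) 0, (e j : Oct) 1, -(e j : Oct) 2 / 2 - b * (e j : Oct) 3,
    -(e j : Oct) 3 / 2 + b * (e j : Oct) 2, -(e j : Oct) 4 / 2 - b * (e j : Oct) 5,
    -(e j : Oct) 5 / 2 + b * (e j : Oct) 4, -(e j : Oct) 6 / 2 - b * (e j : Oct) 7,
    -(e j : Oct) 7 / 2 + b * (e j : Oct) 6] i

theorem zetaMat_mulVec (b : ℂ) (x : Oct) : zetaMat b *ᵥ x =
    ![x 0, x 1, -x 2 / 2 - b * x 3, -x 3 / 2 + b * x 2, -x 4 / 2 - b * x 5, -x 5 / 2 + b * x 4,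
      -x 6 / 2 - b * x 7, -x 7 / 2 + b * x 6] := by
  ext k
  fin_cases k <;> simp [zetaMat, mulVec, dotProduct, Fin.sum_univ_eight, e] <;> ring

theorem transpose_eq_of_dotProduct {A B : Mat8}
    (h : ∀ x y : Oct, (A *ᵥ x) ⬝ᵥ y = x ⬝ᵥ (B *ᵥ y)) : Aᵀ = B := by
  ext i j
  have := h (e i) (e j)
  rwa [dotProduct_e, e_dotProduct, mulVec_e_apply, mulVec_e_apply] at this

theorem zetaMat_transpose (b : ℂ) : (zetaMat b)ᵀ = zetaMat (-b) :=
  transpose_eq_of_dotProduct fun x y => by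
    simp only [zetaMat_mulVec, dotProduct, Fin.sum_univ_eight, Matrix.cons_val]
    ring

theorem zetaMat_neg_mul {b : ℂ} (hb : b ^ 2 = 3 / 4) : zetaMat (-b) * zetaMat b = 1 := by
  apply ext_mulVec
  intro x
  rw [← mulVec_mulVec, zetaMat_mulVec, zetaMat_mulVec, one_mulVec]
  ext k
  fin_cases k <;> simp
  · linear_combination (x 2) * hb
  · linear_combination (x 3) * hb
  · linear_combination (x 4) * hb
  · linear_combination (x 5) * hb
  · linear_combination (x 6) * hb
  · linear_combination (x 7) * hb

theorem zetaMat_mul_self {b : ℂ} (hb : b ^ 2 = 3 / 4) : zetaMat b * zetaMat b = zetaMat (-b) := by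
  apply ext_mulVec
  intro x
  rw [← mulVec_mulVec, zetaMat_mulVec, zetaMat_mulVec, zetaMat_mulVec]
  ext k
  fin_cases k <;> simp
  · linear_combination -(x 2) * hb
  · linear_combination -(x 3) * hb
  · linear_combination -(x 4) * hb
  · linear_combination -(x 5) * hb
  · linear_combination -(x 6) * hb
  · linear_combination -(x 7) * hb

/-- The matrix is the square of its orthogonal inverse `zetaMat (-b)`. -/
theorem det_zetaMat {b : ℂ} (hb : b ^ 2 = 3 / 4) : (zetaMat b).det = 1 := by
  have hb' : (-b) ^ 2 = 3 / 4 := by rw [neg_sq, hb]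
  have h := zetaMat_mul_self hb'
  rw [neg_neg] at h
  rw [← h, det_mul]
  apply sq_det_of_orthogonal
  rw [zetaMat_transpose]
  exact zetaMat_neg_mul hb'

/-- View the complement of e₀, e₁ as a three-dimensional space over the span of e₀, e₁. The product
of two of its vectors has a component in it that is conjugate-linear in each, and a cube root of
unity satisfies ω̄² = ω. -/
theorem omul_zetaMat {b : ℂ} (hb : b ^ 2 = 3 / 4) (x y : Oct) :
    omul (zetaMat b *ᵥ x) (zetaMat b *ᵥ y) = zetaMat b *ᵥ omul x y := by
  rw [zetaMat_mulVec, zetaMat_mulVec, zetaMat_mulVec]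
  ext k
  fin_cases k <;> simp [omul]
  · linear_combination (-(x 2 * y 2) - x 3 * y 3 - x 4 * y 4 - x 5 * y 5 - x 6 * y 6
      - x 7 * y 7) * hb
  · linear_combination (x 2 * y 3 - x 3 * y 2 + x 4 * y 5 - x 5 * y 4 + x 6 * y 7 - x 7 * y 6) * hb
  · linear_combination (x 4 * y 6 - x 5 * y 7 - x 6 * y 4 + x 7 * y 5) * hb
  · linear_combination (-(x 4 * y 7) - x 5 * y 6 + x 6 * y 5 + x 7 * y 4) * hb
  · linear_combination (-(x 2 * y 6) + x 3 * y 7 + x 6 * y 2 - x 7 * y 3) * hb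
  · linear_combination (x 2 * y 7 + x 3 * y 6 - x 6 * y 3 - x 7 * y 2) * hb
  · linear_combination (x 2 * y 4 - x 3 * y 5 - x 4 * y 2 + x 5 * y 3) * hb
  · linear_combination (-(x 2 * y 5) - x 3 * y 4 + x 4 * y 3 + x 5 * y 2) * hb

/-- `zetaMat b` is built from left multiplication by e₁ and the coordinates along e₀ and e₁, all of
which an automorphism fixing e₁ respects. -/
theorem zetaMat_commute {g : SL8} (hg : g ∈ SL3) (b : ℂ) :
    (g : Mat8) * zetaMat b = zetaMat b * (g : Mat8) := by
  have hz : ∀ x : Oct, zetaMat b *ᵥ x = (-2⁻¹ : ℂ) • x + b • omul (e 1) x +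
      x 0 • ((3 / 2 : ℂ) • e 0 - b • e 1) + x 1 • ((3 / 2 : ℂ) • e 1 + b • e 0) := by
    intro x
    rw [zetaMat_mulVec]
    ext k
    simp only [Pi.add_apply, Pi.smul_apply, Pi.sub_apply, smul_eq_mul]
    fin_cases k <;> simp [omul, e] <;> ring
  have h0 := mulVec_e_zero_of_mem_G2 hg.1
  apply ext_mulVec
  intro x
  have hx0 : ((g : Mat8) *ᵥ x) 0 = x 0 := by
    rw [← e_dotProduct 0 ((g : Mat8) *ᵥ x), ← h0, dotProduct_mulVec_of_mem_SO8 hg.1.1,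
      e_dotProduct]
  have hx1 : ((g : Mat8) *ᵥ x) 1 = x 1 := by
    rw [← e_dotProduct 1 ((g : Mat8) *ᵥ x), ← hg.2, dotProduct_mulVec_of_mem_SO8 hg.1.1,
      e_dotProduct]
  rw [← mulVec_mulVec, ← mulVec_mulVec, hz, hz, hx0, hx1]
  simp only [mulVec_add, mulVec_sub, mulVec_smul, ← hg.1.2, h0, hg.2]

theorem commute_of_mem_lieAlg_SL3 {X : Mat8} (hX : X ∈ lieAlg SL3) (b : ℂ) :
    X * zetaMat b = zetaMat b * X := by
  induction hX using LieSubalgebra.lieSpan_induction with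
  | mem X hX =>
    refine commute_of_exp fun t => ?_
    obtain ⟨g, hg, hgX⟩ := hX t
    rw [← ofReal_smul_matrix, ← hgX]
    exact zetaMat_commute hg b
  | zero => simp
  | add X Y _ _ hX hY => rw [Matrix.add_mul, Matrix.mul_add, hX, hY]
  | smul c X _ hX => rw [Matrix.smul_mul, Matrix.mul_smul, hX]
  | lie X Y _ _ hX hY =>
    rw [LieRing.of_associative_ring_bracket, Matrix.sub_mul, Matrix.mul_sub, Matrix.mul_assoc, hY,
      ← Matrix.mul_assoc, hX, Matrix.mul_assoc Y, hX, ← Matrix.mul_assoc Y, hY,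
      Matrix.mul_assoc, Matrix.mul_assoc]

/-- An instance of 1 + ω + ω² = 0: `tauG2` has no component invariant under conjugation by the
order-three element. -/
theorem tauG2_average {b : ℂ} (hb : b ^ 2 = 3 / 4) (t : ℂ) :
    tauG2 t + zetaMat b * tauG2 t * zetaMat (-b) + zetaMat (-b) * tauG2 t * zetaMat b = 0 := by
  apply ext_mulVec
  intro x
  simp only [add_mulVec, ← mulVec_mulVec, zetaMat_mulVec, tauG2_mulVec, zero_mulVec]
  ext k
  fin_cases k <;> simp
  · ring
  · ring
  · linear_combination -(I * t * x 7) * hb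
  · linear_combination -(I * t * x 6) * hb
  · linear_combination (I * t * x 5) * hb
  · linear_combination (I * t * x 4) * hb

/-- The order-three element centralizes Lie `SL3`, so the three conjugates of `tauG2 1` pair equally
with Y; their sum is zero. -/
theorem killingForm_tauG2 (hAG : tauG2 1 ∈ lieAlg G2) {Y : Mat8} (hY : Y ∈ lieAlg G2)
    (hYH : Y ∈ lieAlg SL3) : killingForm ℂ (lieAlg G2) ⟨tauG2 1, hAG⟩ ⟨Y, hY⟩ = 0 := by
  obtain ⟨b, hb⟩ := IsAlgClosed.exists_pow_nat_eq (3 / 4 : ℂ) (n := 2) (by norm_num)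
  have key : ∀ b : ℂ, b ^ 2 = 3 / 4 → ∃ X : lieAlg G2,
      (X : Mat8) = zetaMat b * tauG2 1 * zetaMat (-b) ∧
      killingForm ℂ (lieAlg G2) X ⟨Y, hY⟩ = killingForm ℂ (lieAlg G2) ⟨tauG2 1, hAG⟩ ⟨Y, hY⟩ := by
    intro b hb
    have horth : (zetaMat b)ᵀ * zetaMat b = 1 := by
      rw [zetaMat_transpose]
      exact zetaMat_neg_mul hb
    let z : SL8 := ⟨zetaMat b, det_zetaMat hb⟩
    have hz8 : z ∈ SO8 := horth
    have hz : z ∈ G2 := ⟨hz8, omul_zetaMat hb⟩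
    have hzi : ((z⁻¹ : SL8) : Mat8) = zetaMat (-b) := by
      rw [coe_inv_of_mem_SO8 hz8, ← zetaMat_transpose]
    refine ⟨adEquiv hz ⟨tauG2 1, hAG⟩, by rw [coe_adEquiv, hzi], ?_⟩
    have hYz : adEquiv hz ⟨Y, hY⟩ = ⟨Y, hY⟩ := by
      apply Subtype.ext
      rw [coe_adEquiv, hzi]
      change zetaMat b * Y * zetaMat (-b) = Y
      have h := zetaMat_neg_mul (b := -b) (by rw [neg_sq, hb])
      rw [neg_neg] at h
      rw [← commute_of_mem_lieAlg_SL3 hYH b, Matrix.mul_assoc, h, Matrix.mul_one]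
    conv_lhs => rw [← hYz]
    exact killingForm_adEquiv hz _ _
  obtain ⟨X, hX, hXY⟩ := key b hb
  obtain ⟨X', hX', hXY'⟩ := key (-b) (by rw [neg_sq, hb])
  rw [neg_neg] at hX'
  have hsum : (⟨tauG2 1, hAG⟩ : lieAlg G2) + X + X' = 0 := by
    apply Subtype.ext
    change tauG2 1 + (X : Mat8) + (X' : Mat8) = 0
    rw [hX, hX', tauG2_average hb]
  have h := congrArg (fun Z => killingForm ℂ (lieAlg G2) Z ⟨Y, hY⟩) hsum
  simp only [map_add, LinearMap.add_apply, hXY, hXY', map_zero, LinearMap.zero_apply] at h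
  linear_combination h / 3

/-! ### Arbitrary Cartan involutions preserving `H` -/

/-- Such an A is Hermitian, so the conjugate of exp A is its transpose, which is exp(−A). -/
theorem conjSL_expSkew {A : Mat8} (hA : Aᵀ = -A) (hc : A.map (starRingEnd ℂ) = -A) :
    conjSL (expSkew A hA) = (expSkew A hA)⁻¹ := by
  have h1 : conjSL (expSkew A hA) = expSkew (-A) (by rw [transpose_neg, hA]) := by
    apply Subtype.ext
    change (NormedSpace.exp A).map (starRingEnd ℂ) = NormedSpace.exp (-A)
    have h := Matrix.exp_conjTranspose A
    have hAH : Aᴴ = A := by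
      rw [conjTranspose, hA, show (-A).map star = -A.map (starRingEnd ℂ) by ext; simp, hc, neg_neg]
    rw [hAH] at h
    have h2 : (NormedSpace.exp A).map (starRingEnd ℂ) = ((NormedSpace.exp A)ᴴ)ᵀ := by
      ext; simp
    rw [h2, ← h, ← Matrix.exp_transpose, hA]
  rw [h1]
  exact eq_inv_of_mul_eq_one_left (expSkew_neg_mul _ _)

theorem theta_mul_of_real {v k : SL8} (hk : conjSL k = k) (g : SL8) :
    theta (v * k) g = theta v g := by
  simp only [theta, map_mul, map_inv, hk, _root_.mul_inv_rev]
  group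

theorem dtheta_mul_conjLie {v k : SL8} (hk : conjSL k = k) {Z : Mat8}
    (hZ : Z.map (starRingEnd ℂ) = Z) : dtheta (v * k) (conjLie v Z) = conjLie v Z := by
  have hkm : (k : Mat8).map (starRingEnd ℂ) = k := congrArg Subtype.val hk
  have hki : ((k⁻¹ : SL8) : Mat8).map (starRingEnd ℂ) = ((k⁻¹ : SL8) : Mat8) := by
    rw [← coe_conjSL, map_inv, hk]
  have h1 : (((v * k)⁻¹ : SL8) : Mat8) * conjLie v Z * ((v * k : SL8) : Mat8) =
      ((k⁻¹ : SL8) : Mat8) * Z * (k : Mat8) := by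
    rw [_root_.mul_inv_rev, Matrix.SpecialLinearGroup.coe_mul, Matrix.SpecialLinearGroup.coe_mul,
      conjLie_apply]
    calc _ = ((k⁻¹ : SL8) : Mat8) * (((v⁻¹ : SL8) : Mat8) * (v : Mat8)) * Z *
          (((v⁻¹ : SL8) : Mat8) * (v : Mat8)) * (k : Mat8) := by noncomm_ring
      _ = _ := by rw [coe_inv_mul_coe, Matrix.mul_one, Matrix.mul_one]
  rw [dtheta, h1, Matrix.map_mul, Matrix.map_mul, hZ, hkm, hki, _root_.mul_inv_rev,
    Matrix.SpecialLinearGroup.coe_mul, Matrix.SpecialLinearGroup.coe_mul, conjLie_apply]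
  calc _ = (v : Mat8) * ((k : Mat8) * ((k⁻¹ : SL8) : Mat8)) * Z *
        ((k : Mat8) * ((k⁻¹ : SL8) : Mat8)) * ((v⁻¹ : SL8) : Mat8) := by noncomm_ring
    _ = _ := by rw [coe_mul_coe_inv, Matrix.mul_one, Matrix.mul_one]

theorem mem_lieAlg_of_exp {G : Subgroup SL8} {A : Mat8} {m : ℂ → SL8}
    (hm : ∀ t, (m t : Mat8) = NormedSpace.exp (t • A)) (hmG : ∀ t, m t ∈ G) : A ∈ lieAlg G :=
  LieSubalgebra.subset_lieSpan fun t => ⟨m t, hmG t, hm t⟩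

/-- Conjugation by v ∈ H preserves G, H and the Killing form and turns θ₁ into θ_v, which equals
θ_{vk} for real k. The standard involution is the case v = k = 1. -/
theorem isRankOneCartanDecomposition_mul {G H : Subgroup SL8} (hHG : H ≤ G) {A : Mat8}
    {m : ℂ → SL8} (hm : ∀ t, (m t : Mat8) = NormedSpace.exp (t • A)) (hmG : ∀ t, m t ∈ G)
    (hA0 : A ≠ 0) (hA : A.map (starRingEnd ℂ) = -A)
    (hkill : ∀ (hX : A ∈ lieAlg G) {Y : Mat8} (hY : Y ∈ lieAlg G), Y ∈ lieAlg H →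
      killingForm ℂ (lieAlg G) ⟨A, hX⟩ ⟨Y, hY⟩ = 0)
    (hdec : ∀ g ∈ G, ∃ k ∈ G, conjSL k = k ∧ ∃ t : ℝ, ∃ h ∈ H, g = k * m t * h)
    {v k : SL8} (hv : v ∈ H) (hk : conjSL k = k) :
    IsRankOneCartanDecomposition G H (v * k) (Submodule.span ℝ {conjLie v A}) := by
  have hvG := hHG hv
  have hAG : A ∈ lieAlg G := mem_lieAlg_of_exp hm hmG
  have hvA : conjLie v A ∈ lieAlg G := conjLie_mem_lieAlg hvG hAG
  refine ⟨?_, ?_, ?_, ?_, ?_⟩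
  · refine finrank_span_singleton fun h => hA0 ?_
    rw [← conjLie_inv_conjLie v A, h, map_zero]
  · intro X hX Y hY
    obtain ⟨a, rfl⟩ := Submodule.mem_span_singleton.mp hX
    obtain ⟨b, rfl⟩ := Submodule.mem_span_singleton.mp hY
    rw [LieRing.of_associative_ring_bracket, smul_mul_smul_comm, smul_mul_smul_comm, mul_comm a b,
      sub_self]
  · intro X hX
    obtain ⟨a, rfl⟩ := Submodule.mem_span_singleton.mp hX
    have hY : (-I * (a : ℂ)) • conjLie v A = conjLie v ((-I * (a : ℂ)) • A) := (map_smul _ _ _).symm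
    refine ⟨(-I * (a : ℂ)) • conjLie v A, ⟨LieSubalgebra.smul_mem _ _ hvA, ?_⟩, ?_⟩
    · rw [hY]
      apply dtheta_mul_conjLie hk
      have : ((-I * (a : ℂ)) • A).map (starRingEnd ℂ) =
          (I * (a : ℂ)) • A.map (starRingEnd ℂ) := by
        ext; simp
      rw [this, hA]
      module
    · rw [smul_smul, ← mul_assoc, mul_neg, I_mul_I, neg_neg, one_mul]
      rfl
  · intro X hX
    obtain ⟨a, rfl⟩ := Submodule.mem_span_singleton.mp hX
    refine ⟨LieSubalgebra.smul_mem _ (a : ℂ) hvA, fun Y hY hYH => ?_⟩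
    have h1 : killingForm ℂ (lieAlg G) ⟨conjLie v A, hvA⟩ ⟨Y, hY⟩ = 0 := by
      -- Pull Y back by v⁻¹; as v ∈ H, it stays in Lie H.
      have h2 := hkill hAG (conjLie_mem_lieAlg (inv_mem hvG) hY)
        (conjLie_mem_lieAlg (inv_mem hv) hYH)
      rw [← killingForm_adEquiv hvG] at h2
      have h3 : adEquiv hvG ⟨conjLie v⁻¹ Y, conjLie_mem_lieAlg (inv_mem hvG) hY⟩ = ⟨Y, hY⟩ :=
        Subtype.ext (conjLie_conjLie_inv v Y)
      rw [h3] at h2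
      exact h2
    have h4 : (⟨a • conjLie v A, LieSubalgebra.smul_mem _ (a : ℂ) hvA⟩ : lieAlg G) =
        (a : ℂ) • ⟨conjLie v A, hvA⟩ := rfl
    rw [h4, map_smul, LinearMap.smul_apply, h1, smul_zero]
  · ext M
    constructor
    · rintro ⟨g, hg, rfl⟩
      obtain ⟨k₀, hk₀, hkc, t, h, hh, hg'⟩ :=
        hdec (v⁻¹ * g * v) (mul_mem (mul_mem (inv_mem hvG) hg) hvG)
      refine ⟨v * k₀ * v⁻¹, ⟨mul_mem (mul_mem hvG hk₀) (inv_mem hvG), ?_⟩, t • conjLie v A,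
        Submodule.smul_mem _ _ (Submodule.mem_span_singleton_self _), v * h * v⁻¹,
        mul_mem (mul_mem hv hh) (inv_mem hv), ?_⟩
      · rw [theta_mul_of_real hk, theta]
        have : v⁻¹ * (v * k₀ * v⁻¹) * v = k₀ := by group
        rw [this, hkc]
      · have h1 : NormedSpace.exp (t • conjLie v A) = ((v * m t * v⁻¹ : SL8) : Mat8) := by
          rw [Matrix.SpecialLinearGroup.coe_mul, Matrix.SpecialLinearGroup.coe_mul, hm,
            ← exp_conjLie, map_smul]
          rfl
        have h2 : g = v * k₀ * v⁻¹ * (v * m t * v⁻¹) * (v * h * v⁻¹) := by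
          calc g = v * (v⁻¹ * g * v) * v⁻¹ := by group
            _ = _ := by rw [hg']; group
        change (g : Mat8) = _
        rw [h1, ← Matrix.SpecialLinearGroup.coe_mul, ← Matrix.SpecialLinearGroup.coe_mul, ← h2]
    · rintro ⟨k₀, hk₀, X, hX, h, hh, rfl⟩
      obtain ⟨a, rfl⟩ := Submodule.mem_span_singleton.mp hX
      refine ⟨k₀ * (v * m a * v⁻¹) * h, mul_mem (mul_mem hk₀.1
        (mul_mem (mul_mem hvG (hmG a)) (inv_mem hvG))) (hHG hh), ?_⟩
      change ((k₀ * (v * m a * v⁻¹) * h : SL8) : Mat8) = _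
      rw [Matrix.SpecialLinearGroup.coe_mul, Matrix.SpecialLinearGroup.coe_mul,
        Matrix.SpecialLinearGroup.coe_mul, Matrix.SpecialLinearGroup.coe_mul, hm,
        ← exp_conjLie, map_smul]
      rfl

/-- If `θ_u` preserves `H`, then `θ_u = θ_v` for some `v ∈ H`. -/
theorem exists_eq_mul_of_theta_image {G H : Subgroup SL8} {m : ℂ → SL8}
    (hadd : ∀ s t, m (s + t) = m s * m t) (hconj : ∀ t : ℝ, conjSL (m t) = (m t)⁻¹)
    (hHc : ∀ h ∈ H, conjSL h ∈ H)
    (hdec : ∀ g ∈ G, ∃ k ∈ G, conjSL k = k ∧ ∃ t : ℝ, ∃ h ∈ H, g = k * m t * h)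
    (hnorm : ∀ t : ℝ, (∀ x ∈ H, (m t)⁻¹ * x * m t ∈ H) → t = 0)
    {u : SL8} (hu : u ∈ G) (hθ : theta u '' (H : Set SL8) = H) :
    ∃ v ∈ H, ∃ k : SL8, conjSL k = k ∧ u = v * k := by
  -- Decomposing u⁻¹ rather than u puts the factor from H on the left of u.
  obtain ⟨k, -, hk, t, h, hh, huk⟩ := hdec u⁻¹ (inv_mem hu)
  have hm0 : m 0 = 1 := by
    have := hadd 0 0
    rwa [add_zero, left_eq_mul] at this
  have hu' : u = h⁻¹ * (m t)⁻¹ * k⁻¹ := by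
    rw [← inv_inv u, huk]
    group
  have ht : 2 * t = 0 := by
    apply hnorm
    intro x hx
    have hy : conjSL ((conjSL h)⁻¹ * x * conjSL h) ∈ H :=
      hHc _ (mul_mem (mul_mem (inv_mem (hHc h hh)) hx) (hHc h hh))
    have h1 : theta u (conjSL ((conjSL h)⁻¹ * x * conjSL h)) ∈ H := by
      have : theta u (conjSL ((conjSL h)⁻¹ * x * conjSL h)) ∈ theta u '' (H : Set SL8) :=
        ⟨_, hy, rfl⟩
      rwa [hθ] at this
    -- The parameter doubles because conjugation inverts m t: u ū⁻¹ = h⁻¹ (m 2t)⁻¹ h̄. The argument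
    -- of `theta u` is chosen to absorb h̄.
    have h2 : theta u (conjSL ((conjSL h)⁻¹ * x * conjSL h)) =
        h⁻¹ * ((m ((2 * t : ℝ) : ℂ))⁻¹ * x * m ((2 * t : ℝ) : ℂ)) * h := by
      have hm2 : m ((2 * t : ℝ) : ℂ) = m t * m t := by
        rw [← hadd]
        push_cast
        ring_nf
      rw [hm2, hu']
      simp only [theta, map_mul, map_inv, conjSL_conjSL, hk, hconj, _root_.mul_inv_rev, inv_inv]
      group
    rw [h2] at h1
    have h3 := mul_mem (mul_mem hh h1) (inv_mem hh)
    have h4 : h * (h⁻¹ * ((m ((2 * t : ℝ) : ℂ))⁻¹ * x * m ((2 * t : ℝ) : ℂ)) * h) * h⁻¹ =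
        (m ((2 * t : ℝ) : ℂ))⁻¹ * x * m ((2 * t : ℝ) : ℂ) := by group
    rwa [h4] at h3
  have ht0 : t = 0 := by linarith
  refine ⟨h⁻¹, inv_mem hh, k⁻¹, by rw [map_inv, hk], ?_⟩
  rw [hu', ht0, ofReal_zero, hm0]
  group

/-- Isolates what each pair must supply: a skew, purely imaginary generator, its Killing
orthogonality to Lie H, the decomposition for θ₁, and the fact that no nontrivial real-parameter
element conjugates H into itself. -/
theorem isRankOneCartanDecomposition_pair {G H : Subgroup SL8} (hHG : H ≤ G)
    (hHc : ∀ h ∈ H, conjSL h ∈ H) {A : Mat8} (hAT : Aᵀ = -A) (hA0 : A ≠ 0)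
    (hA : A.map (starRingEnd ℂ) = -A) {m : ℂ → SL8}
    (hm : ∀ t, (m t : Mat8) = NormedSpace.exp (t • A)) (hmG : ∀ t, m t ∈ G)
    (hkill : ∀ (hX : A ∈ lieAlg G) {Y : Mat8} (hY : Y ∈ lieAlg G), Y ∈ lieAlg H →
      killingForm ℂ (lieAlg G) ⟨A, hX⟩ ⟨Y, hY⟩ = 0)
    (hdec : ∀ g ∈ G, ∃ k ∈ G, conjSL k = k ∧ ∃ t : ℝ, ∃ h ∈ H, g = k * m t * h)
    (hnorm : ∀ t : ℝ, (∀ x ∈ H, (m t)⁻¹ * x * m t ∈ H) → t = 0) :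
    IsRankOneCartanDecomposition G H 1 (Submodule.span ℝ {A}) ∧
      ∀ u ∈ G, theta u '' (H : Set SL8) = H →
        ∃ a : Submodule ℝ Mat8, IsRankOneCartanDecomposition G H u a := by
  constructor
  · have h := isRankOneCartanDecomposition_mul hHG hm hmG hA0 hA hkill hdec (one_mem H)
      (map_one conjSL)
    have h1 : conjLie 1 A = A := by simp [conjLie_apply]
    rwa [mul_one, h1] at h
  · intro u hu hθ
    have hadd : ∀ s t, m (s + t) = m s * m t := fun s t => by
      apply Subtype.ext
      change (m (s + t) : Mat8) = (m s : Mat8) * (m t : Mat8)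
      rw [hm, hm, hm, add_smul, Matrix.exp_add_of_commute]
      exact ((Commute.refl A).smul_left s).smul_right t
    have hconj : ∀ t : ℝ, conjSL (m t) = (m t)⁻¹ := fun t => by
      have hT : ((t : ℂ) • A)ᵀ = -((t : ℂ) • A) := by rw [transpose_smul, hAT, smul_neg]
      have : m t = expSkew ((t : ℂ) • A) hT := Subtype.ext (hm t)
      rw [this]
      apply conjSL_expSkew
      rw [← smul_neg, ← hA]
      ext; simp
    obtain ⟨v, hv, k, hk, rfl⟩ := exists_eq_mul_of_theta_image hadd hconj hHc hdec hnorm hu hθ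
    exact ⟨_, isRankOneCartanDecomposition_mul hHG hm hmG hA0 hA hkill hdec hv hk⟩

/-! ### The three pairs -/

theorem map_eq_neg_of_mulVec {A : Mat8} (h : ∀ x : Oct, star (A *ᵥ x) = -(A *ᵥ star x)) :
    A.map (starRingEnd ℂ) = -A := by
  apply ext_mulVec
  intro x
  rw [← star_star x, ← star_mulVec_map, h, neg_mulVec]

theorem aSO7_eq_span : aSO7 = Submodule.span ℝ {alphaSO7 1} := by
  ext X
  rw [Submodule.mem_span_singleton]
  exact exists_congr fun t => by rw [alphaSO7_eq_smul, eq_comm]; rfl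

theorem aSpin7_eq_span : aSpin7 = Submodule.span ℝ {alphaSpin7 1} := by
  ext X
  rw [Submodule.mem_span_singleton]
  exact exists_congr fun t => by rw [alphaSpin7_eq_smul, eq_comm]; rfl

theorem aG2_eq_span : aG2 = Submodule.span ℝ {tauG2 1} := by
  ext X
  rw [Submodule.mem_span_singleton]
  exact exists_congr fun t => by rw [tauG2_eq_smul, eq_comm]; rfl

theorem isRankOne_SO7 :
    IsRankOneCartanDecomposition SO7 G2 1 aSO7 ∧
      ∀ u ∈ SO7, theta u '' (G2 : Set SL8) = G2 →
        ∃ a : Submodule ℝ Mat8, IsRankOneCartanDecomposition SO7 G2 u a := by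
  rw [aSO7_eq_span]
  refine isRankOneCartanDecomposition_pair G2_le_SO7 (fun _ => conjSL_mem_G2)
    (alphaSO7_transpose 1) (fun h => ?_) (map_eq_neg_of_mulVec fun x => ?_) (m := expSO7)
    (fun t => by rw [← alphaSO7_eq_smul]; rfl) expSO7_mem
    (fun hX _ hY => killingForm_eq_zero_of_commute G2_le_SO7 ?_ ?_ hX hY)
    (fun _ => exists_decomposition_SO7) (fun _ => eq_zero_of_normalize_SO7)
  · have := congrFun (congrFun h 3) 2
    simp [alphaSO7] at this
  · rw [alphaSO7_mulVec, alphaSO7_mulVec]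
    ext k
    fin_cases k <;> simp
  · rintro d (rfl | rfl) i j <;> fin_cases i <;> fin_cases j <;> simp [alphaSO7, signA, signB]
  · intro i j
    fin_cases i <;> fin_cases j <;> simp [alphaSO7, cyc]

theorem isRankOne_Spin7 :
    IsRankOneCartanDecomposition Spin7 G2 1 aSpin7 ∧
      ∀ u ∈ Spin7, theta u '' (G2 : Set SL8) = G2 →
        ∃ a : Submodule ℝ Mat8, IsRankOneCartanDecomposition Spin7 G2 u a := by
  rw [aSpin7_eq_span]
  refine isRankOneCartanDecomposition_pair G2_le_Spin7 (fun _ => conjSL_mem_G2)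
    (alphaSpin7_transpose 1) (fun h => ?_) (map_eq_neg_of_mulVec fun x => ?_) (m := expSpin7)
    (fun t => by rw [← alphaSpin7_eq_smul]; rfl) expSpin7_mem
    (fun hX _ hY => killingForm_eq_zero_of_commute G2_le_Spin7 ?_ ?_ hX hY)
    (fun _ => exists_decomposition_Spin7) (fun _ => eq_zero_of_normalize_Spin7)
  · have := congrFun (congrFun h 1) 0
    simp [alphaSpin7] at this
  · rw [alphaSpin7_mulVec, alphaSpin7_mulVec]
    ext k
    fin_cases k <;> simp <;> ring
  · rintro d (rfl | rfl) i j <;> fin_cases i <;> fin_cases j <;> simp [alphaSpin7, signA, signB]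
  · intro i j
    fin_cases i <;> fin_cases j <;> simp [alphaSpin7, cyc]

theorem isRankOne_G2 :
    IsRankOneCartanDecomposition G2 SL3 1 aG2 ∧
      ∀ u ∈ G2, theta u '' (SL3 : Set SL8) = SL3 →
        ∃ a : Submodule ℝ Mat8, IsRankOneCartanDecomposition G2 SL3 u a := by
  rw [aG2_eq_span]
  refine isRankOneCartanDecomposition_pair SL3_le_G2 (fun _ => conjSL_mem_SL3)
    (tauG2_transpose 1) (fun h => ?_) (map_eq_neg_of_mulVec fun x => ?_) (m := expG2)
    (fun t => by rw [← tauG2_eq_smul]; rfl) expG2_mem killingForm_tauG2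
    (fun _ => exists_decomposition_G2) (fun _ => eq_zero_of_normalize_G2)
  · have := congrFun (congrFun h 2) 1
    simp [tauG2] at this
  · rw [tauG2_mulVec, tauG2_mulVec]
    ext k
    fin_cases k <;> simp <;> ring

end CartanRankOne

open CartanRankOne in
theorem theorem1p1 :
    IsRankOneCartanDecomposition SO7 G2 1 aSO7 ∧
    IsRankOneCartanDecomposition Spin7 G2 1 aSpin7 ∧
    IsRankOneCartanDecomposition G2 SL3 1 aG2 ∧
    ∀ G H : Subgroup SL8, (G = SO7 ∧ H = G2) ∨ (G = Spin7 ∧ H = G2) ∨ (G = G2 ∧ H = SL3) →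
      ∀ u ∈ G, theta u '' (H : Set SL8) = H →
        ∃ a : Submodule ℝ Mat8, IsRankOneCartanDecomposition G H u a := by
  refine ⟨isRankOne_SO7.1, isRankOne_Spin7.1, isRankOne_G2.1, ?_⟩
  rintro G H (⟨rfl, rfl⟩ | ⟨rfl, rfl⟩ | ⟨rfl, rfl⟩)
  exacts [isRankOne_SO7.2, isRankOne_Spin7.2, isRankOne_G2.2]
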